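/- Let $0<q<1$, let $n\ge 0$ be an integer and $a_1,\dots,a_n\in\mathbb Z_{\ge 0}$; write $|A|=\sum_j a_j$. **Notation.** $(a;p)_k=\prod_{l=0}^{k-1}(1-ap^l)$, $[m]_p!=\prod_{j=1}^m\frac{p^j-1}{p-1}$, $e_p(z)=\sum_{k\ge0}\frac{z^k}{(p;p)_k}$, $E_p(z)=\sum_{k\ge0}\frac{p^{k(k-1)/2}z^k}{(p;p)_k}$. The discrete $p$-Hermite polynomials I and II are $$h_l(z;p)=(p;p)_l\sum_{k=0}^{\lfloor l/2\rfloor}\frac{(-1)^kp^{k(k-1)}z^{l-2k}}{(p^2;p^2)_k(p;p)_{l-2k}},\qquad \tilde h_l(z;p)=(p;p)_l\sum_{k=0}^{\lfloor l/2\rfloor}\frac{(-1)^kp^{-2kl+k(2k+1)}z^{l-2k}}{(p^2;p^2)_k(p;p)_{l-2k}}.$$ **Algebras.** $\hat V$ is the complex algebra of formal power series in $x_1,\dots,x_n$ with $x_ix_j=q\,x_jx_i$ for $i>j$; $V$ is the complex algebra of formal power series in $\partial_1,\dots,\partial_n$ with $\partial_i\partial_j=q\,\partial_j\partial_i$ for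 $i<j$. On $V$ let $S$ be the braided antipode: the linear map (degree-preserving, extended to series termwise by degree) with $S(1)=1$, $S(\partial_i)=-\partial_i$ and $S\circ m=m\circ(S\otimes S)\circ\Phi$, where $m$ is the product and the braiding $\Phi$ is compatible with $m$ and given by $\Phi(\partial_i\otimes\partial_j)=q\,\partial_j\otimes\partial_i$ for $i>j$, $q^2\,\partial_i\otimes\partial_i$ for $i=j$, and $(q^2-1)\,\partial_i\otimes\partial_j+q\,\partial_j\otimes\partial_i$ for $i<j$. For scalars $c_j$ put $$\exp(x\,|\,c_1\partial_1,\dots,c_n\partial_n)=\sum_{E\in\mathbb Z_{\ge0}^n}x_1^{e_1}\cdots x_n^{e_n}\otimes\frac{(c_n\partial_n)^{e_n}}{[e_n]_{q^2}!}\cdots\frac{(c_1\partial_1)^{e_1}}{[e_1]_{q^2}!}.$$ **Integral.** For $f=\sum_Ef_E\,x_1^{e_1}\cdots x_n^{e_n}\in\hat V$ let $f_{\cdot1}(z)=\sum_Ef_Ez^E$ be the associated series in commuting variables. Call $f$ *integrable* if $f_{\cdot1}$ converges absolutely near $0$, continues analytically to $\mathbb R^n+iU$ for some open neighbourhood $U$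 of $0$ in $\mathbb R^n$, and $$\sum_{K\in\mathbb Z^n}\sum_{\varepsilon\in\{\pm1\}^n}q^{2|K|}|z_1\cdots z_n|\,|f_{\cdot1}(\varepsilon_1q^{2k_1}z_1,\dots,\varepsilon_nq^{2k_n}z_n)|<\infty$$ for all $z\in\mathbb R^n$ with all $z_j\ne0$ (here $|K|=\sum_jk_j$). For integers $b_1,\dots,b_n\ge0$, the integral $\int_{-q^{b_n}x_n\cdot\infty}^{q^{b_n}x_n\cdot\infty}\cdots\int_{-q^{b_1}x_1\cdot\infty}^{q^{b_1}x_1\cdot\infty}f$ is the formal expression $$(1-q^2)^n\sum_{K\in\mathbb Z^n}\sum_{\varepsilon\in\{\pm1\}^n}q^{2|K|+\sum_jb_j+\binom n2}\,x_1\cdots x_n\,f(\varepsilon_1q^{2k_1+b_1}x_1,\dots,\varepsilon_nq^{2k_n+b_n}x_n);$$ it is identified with the function of $\gamma\in(\mathbb R\setminus\{0\})^n$ obtained by applying $g\mapsto g_{\cdot1}(\gamma)$ (with analytic continuation) to each term and summing. Write $I$ for the case $b=0$, $\Pi_0f=2^{-n}\sum_{\varepsilon\in\{\pm1\}^n}f(\varepsilon_1x_1,\dots,\varepsilon_nx_n)$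 and $I'=I\circ\Pi_0$. Let $\mathcal R$ be the class of $f\in\hat V$ such that $\Pi_0(f\,x_1^{e_1}\cdots x_n^{e_n})$ is integrable for every monomial $x_1^{e_1}\cdots x_n^{e_n}$. **Transform.** For $f\in\mathcal R$ the braided Fourier transform is $$F_S(f)=(I'\otimes S)(m\otimes\mathrm{id})\Bigl(f\otimes\exp\bigl(x\,\big|\,\tfrac{iq^2}{1-q^2}(q^{n-1}\partial_1,\dots,q^{n-j}\partial_j,\dots,\partial_n)\bigr)\Bigr);$$ by the above identification it is a function of $\gamma\in(\mathbb R\setminus\{0\})^n$ with values in $V$. **Theorem.** Let $g_{q^2}=e_{q^4}(-\sum_jx_j^2)$, let $B_j$ be the number of odd entries among $a_1,\dots,a_{j-1}$, and let $$H=e_{q^4}(-x_1^2)\,\tilde h_{a_1}(x_1;q^2)\cdots e_{q^4}(-x_n^2)\,\tilde h_{a_n}(x_n;q^2).$$ Then $H\in\mathcal R$, $g_{q^2}$ is integrable, and, with all products taken in increasing order of the index, $$\begin{aligned}F_S(H)&=\Bigl[\int_{-q^{B_n}x_n\cdot\infty}^{q^{B_n}x_n\cdot\infty}\cdots\int_{-q^{B_1}x_1\cdot\infty}^{q^{B_1}x_1\cdot\infty}g_{q^2}\Bigr]\otimes\prod_{k=1}^n\Bigl[(q^2;q^2)_{a_k}\sum_{s=0}^{\lfloor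 a_k/2\rfloor}\frac{(-i)^{a_k}q^{-a_k^2+a_k}}{(q^4;q^4)_s\,(q^2;q^2)_{a_k-2s}}\,h_{a_k-2s}(\partial_k;q^2)\,E_{q^4}(-q^4\partial_k^2)\Bigr]\\&=\Bigl[\int_{-q^{B_n}x_n\cdot\infty}^{q^{B_n}x_n\cdot\infty}\cdots\int_{-q^{B_1}x_1\cdot\infty}^{q^{B_1}x_1\cdot\infty}g_{q^2}\Bigr](-i)^{|A|}q^{\sum_k(a_k-a_k^2)}\otimes\prod_{j=1}^n\bigl(\partial_j^{a_j}E_{q^4}(-q^4\partial_j^2)\bigr).\end{aligned}$$ Both equalities hold for every $\gamma\in(\mathbb R\setminus\{0\})^n$. -/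

import Mathlib

open Filter Topology

noncomputable section

namespace BraidedFourier

/-! ### Quantum spaces: formal power series in skew-commuting generators -/

/-- Formal power series in generators `u_1, …, u_n` subject to a skew-commutation rule. An element
is the family of its coefficients with respect to a basis `(u^E)` of ordered monomials; the matrix
`c` records the reordering factors: `u^A u^B = (∏_{i,j} c_{ij}^{a_i b_j}) u^{A+B}`. -/
@[ext] structure SkewSeries {n : ℕ} (c : Fin n → Fin n → ℂ) where
  /-- The coefficient of `u^E`. -/
  coeff : (Fin n →₀ ℕ) → ℂ

namespace SkewSeries

variable {n : ℕ} {c : Fin n → Fin n → ℂ}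

/-- The reordering factor of `u^A u^B`. -/
def weight (c : Fin n → Fin n → ℂ) (A B : Fin n →₀ ℕ) : ℂ :=
  ∏ i, ∏ j, c i j ^ (A i * B j)

theorem weight_zero_left (B : Fin n →₀ ℕ) : weight c 0 B = 1 := by
  simp [weight]

theorem weight_zero_right (A : Fin n →₀ ℕ) : weight c A 0 = 1 := by
  simp [weight]

theorem weight_add_left (A A' B : Fin n →₀ ℕ) :
    weight c (A + A') B = weight c A B * weight c A' B := by
  simp [weight, add_mul, pow_add, Finset.prod_mul_distrib]

theorem weight_add_right (A B B' : Fin n →₀ ℕ) :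
    weight c A (B + B') = weight c A B * weight c A B' := by
  simp [weight, mul_add, pow_add, Finset.prod_mul_distrib]

instance : Zero (SkewSeries c) := ⟨⟨fun _ => 0⟩⟩

instance : One (SkewSeries c) := ⟨⟨fun E => if E = 0 then 1 else 0⟩⟩

instance : Add (SkewSeries c) := ⟨fun f g => ⟨fun E => f.coeff E + g.coeff E⟩⟩

instance : Neg (SkewSeries c) := ⟨fun f => ⟨fun E => -f.coeff E⟩⟩

instance : SMul ℂ (SkewSeries c) := ⟨fun r f => ⟨fun E => r * f.coeff E⟩⟩

instance : Mul (SkewSeries c) :=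
  ⟨fun f g => ⟨fun E => ∑ p ∈ Finset.HasAntidiagonal.antidiagonal E,
    weight c p.1 p.2 * (f.coeff p.1 * g.coeff p.2)⟩⟩

theorem coeff_zero (E : Fin n →₀ ℕ) : (0 : SkewSeries c).coeff E = 0 := rfl

theorem coeff_one (E : Fin n →₀ ℕ) :
    (1 : SkewSeries c).coeff E = if E = 0 then 1 else 0 := rfl

theorem coeff_add (f g : SkewSeries c) (E : Fin n →₀ ℕ) :
    (f + g).coeff E = f.coeff E + g.coeff E := rfl

theorem coeff_neg (f : SkewSeries c) (E : Fin n →₀ ℕ) : (-f).coeff E = -f.coeff E := rfl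

theorem coeff_smul (r : ℂ) (f : SkewSeries c) (E : Fin n →₀ ℕ) :
    (r • f).coeff E = r * f.coeff E := rfl

theorem coeff_mul (f g : SkewSeries c) (E : Fin n →₀ ℕ) :
    (f * g).coeff E = ∑ p ∈ Finset.HasAntidiagonal.antidiagonal E,
      weight c p.1 p.2 * (f.coeff p.1 * g.coeff p.2) := rfl

protected theorem mul_assoc (f g h : SkewSeries c) : f * g * h = f * (g * h) := by
  ext E
  simp only [coeff_mul, Finset.sum_mul, Finset.mul_sum, Finset.sum_sigma']
  refine Finset.sum_nbij' (fun ⟨⟨_, k⟩, ⟨i, j⟩⟩ ↦ ⟨(i, j + k), (j, k)⟩)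
    (fun ⟨⟨i, _⟩, ⟨j, k⟩⟩ ↦ ⟨(i + j, k), (i, j)⟩) ?_ ?_ ?_ ?_ ?_
  · rintro ⟨⟨a, k⟩, ⟨i, j⟩⟩ h
    simp only [Finset.mem_sigma, Finset.HasAntidiagonal.mem_antidiagonal] at h ⊢
    exact ⟨by rw [← h.1, ← h.2, add_assoc], trivial⟩
  · rintro ⟨⟨i, a⟩, ⟨j, k⟩⟩ h
    simp only [Finset.mem_sigma, Finset.HasAntidiagonal.mem_antidiagonal] at h ⊢
    exact ⟨by rw [← h.1, ← h.2, add_assoc], trivial⟩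
  · rintro ⟨⟨a, k⟩, ⟨i, j⟩⟩ h
    simp only [Finset.mem_sigma, Finset.HasAntidiagonal.mem_antidiagonal] at h
    simp [h.2]
  · rintro ⟨⟨i, a⟩, ⟨j, k⟩⟩ h
    simp only [Finset.mem_sigma, Finset.HasAntidiagonal.mem_antidiagonal] at h
    simp [h.2]
  · rintro ⟨⟨a, k⟩, ⟨i, j⟩⟩ h
    simp only [Finset.mem_sigma, Finset.HasAntidiagonal.mem_antidiagonal] at h
    obtain ⟨-, rfl⟩ := h
    simp only [weight_add_left, weight_add_right]
    ring

protected theorem one_mul (f : SkewSeries c) : 1 * f = f := by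
  ext E
  rw [coeff_mul, Finset.sum_eq_single (0, E)]
  · simp [coeff_one, weight_zero_left]
  · rintro ⟨a, b⟩ hab hne
    have ha : a ≠ 0 := by
      rintro rfl
      apply hne
      simpa using hab
    simp [coeff_one, ha]
  · simp

protected theorem mul_one (f : SkewSeries c) : f * 1 = f := by
  ext E
  rw [coeff_mul, Finset.sum_eq_single (E, 0)]
  · simp [coeff_one, weight_zero_right]
  · rintro ⟨a, b⟩ hab hne
    have hb : b ≠ 0 := by
      rintro rfl
      apply hne
      simpa using hab
    simp [coeff_one, hb]
  · simp

instance : Ring (SkewSeries c) where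
  add_assoc f g h := by ext E; simp only [coeff_add, add_assoc]
  zero_add f := by ext E; simp only [coeff_add, coeff_zero, zero_add]
  add_zero f := by ext E; simp only [coeff_add, coeff_zero, add_zero]
  add_comm f g := by ext E; simp only [coeff_add, add_comm]
  neg_add_cancel f := by ext E; simp only [coeff_add, coeff_neg, coeff_zero, neg_add_cancel]
  nsmul := nsmulRec
  zsmul := zsmulRec
  mul_assoc := SkewSeries.mul_assoc
  one_mul := SkewSeries.one_mul
  mul_one := SkewSeries.mul_one
  left_distrib f g h := by
    ext E; simp only [coeff_mul, coeff_add, mul_add, Finset.sum_add_distrib]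
  right_distrib f g h := by
    ext E; simp only [coeff_mul, coeff_add, add_mul, mul_add, Finset.sum_add_distrib]
  zero_mul f := by ext E; simp [coeff_mul, coeff_zero]
  mul_zero f := by ext E; simp [coeff_mul, coeff_zero]

instance : Module ℂ (SkewSeries c) where
  one_smul f := by ext E; simp only [coeff_smul, _root_.one_mul]
  mul_smul r s f := by ext E; simp only [coeff_smul, _root_.mul_assoc]
  smul_zero r := by ext E; simp only [coeff_smul, coeff_zero, mul_zero]
  smul_add r f g := by ext E; simp only [coeff_smul, coeff_add, mul_add]
  add_smul r s f := by ext E; simp only [coeff_smul, coeff_add, add_mul]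
  zero_smul f := by ext E; simp only [coeff_smul, coeff_zero, zero_mul]

/-- The generator `u_j`. -/
def gen (c : Fin n → Fin n → ℂ) (j : Fin n) : SkewSeries c :=
  ⟨fun E => if E = Finsupp.single j 1 then 1 else 0⟩

/-- The substitution `f(r_1 u_1, …, r_n u_n)` for scalars `r_j`. -/
def rescale (r : Fin n → ℂ) (f : SkewSeries c) : SkewSeries c :=
  ⟨fun E => (∏ j, r j ^ E j) * f.coeff E⟩

/-- The formal series `∑_k φ_k u^k` for `u` without constant term: then `u^k` has no terms of degree
less than `k`, so that each coefficient is a finite sum. -/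
def evalSeries (φ : ℕ → ℂ) (u : SkewSeries c) : SkewSeries c :=
  ⟨fun E => ∑ k ∈ Finset.range (E.degree + 1), φ k * (u ^ k).coeff E⟩

end SkewSeries

open SkewSeries

/-- The (extended) braided covector algebra: formal power series in `x_1, …, x_n` with
`x_i x_j = q x_j x_i` for `i > j`; coefficients with respect to the increasingly ordered monomials
`x_1^{e_1} ⋯ x_n^{e_n}`. -/
abbrev Cov (q : ℝ) (n : ℕ) : Type :=
  SkewSeries (fun i j : Fin n => if j < i then (q : ℂ) else 1)

/-- The (extended) braided vector algebra: formal power series in `∂_1, …, ∂_n` with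
`∂_i ∂_j = q ∂_j ∂_i` for `i < j`; coefficients with respect to the decreasingly ordered monomials
`∂_n^{e_n} ⋯ ∂_1^{e_1}`. -/
abbrev Vec (q : ℝ) (n : ℕ) : Type :=
  SkewSeries (fun i j : Fin n => if i < j then (q : ℂ) else 1)

/-- The generators `x_j`. -/
def x (q : ℝ) {n : ℕ} (j : Fin n) : Cov q n := SkewSeries.gen _ j

/-- The generators `∂_j`. -/
def dd (q : ℝ) {n : ℕ} (j : Fin n) : Vec q n := SkewSeries.gen _ j

theorem gen_mul_gen {n : ℕ} (c : Fin n → Fin n → ℂ) (i j : Fin n) (E : Fin n →₀ ℕ) :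
    (gen c i * gen c j).coeff E =
      if E = Finsupp.single i 1 + Finsupp.single j 1 then c i j else 0 := by
  have hw : weight c (Finsupp.single i 1) (Finsupp.single j 1) = c i j := by
    rw [weight, Finset.prod_eq_single i, Finset.prod_eq_single j]
    · simp
    · intro b _ hb
      simp [Finsupp.single_eq_of_ne hb]
    · simp
    · intro b _ hb
      simp [Finsupp.single_eq_of_ne hb]
    · simp
  rw [coeff_mul]
  split_ifs with h
  · rw [Finset.sum_eq_single (Finsupp.single i 1, Finsupp.single j 1)]
    · simp [gen, hw]
    · rintro ⟨a, b⟩ _ hne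
      simp only [gen]
      by_cases ha : a = Finsupp.single i 1
      · have hb : b ≠ Finsupp.single j 1 := fun hb => hne (by rw [ha, hb])
        simp [hb]
      · simp [ha]
    · simp [h]
  · refine Finset.sum_eq_zero ?_
    rintro ⟨a, b⟩ hab
    simp only [gen]
    by_cases ha : a = Finsupp.single i 1
    · have hb : b ≠ Finsupp.single j 1 := by
        rintro rfl
        apply h
        rw [← ha]
        exact (Finset.HasAntidiagonal.mem_antidiagonal.1 hab).symm
      simp [hb]
    · simp [ha]

theorem x_mul_x (q : ℝ) {n : ℕ} {i j : Fin n} (h : j < i) :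
    x q i * x q j = (q : ℂ) • (x q j * x q i) := by
  ext E
  simp only [coeff_smul, x, gen_mul_gen, add_comm (Finsupp.single j 1)]
  simp [h, h.le.not_gt]

theorem dd_mul_dd (q : ℝ) {n : ℕ} {i j : Fin n} (h : i < j) :
    dd q i * dd q j = (q : ℂ) • (dd q j * dd q i) := by
  ext E
  simp only [coeff_smul, dd, gen_mul_gen, add_comm (Finsupp.single j 1)]
  simp [h, h.le.not_gt]

/-! ### `q`-special functions -/

/-- The `q`-shifted factorial `(a; p)_k`. -/
def qPoch (a p : ℝ) (k : ℕ) : ℝ := ∏ l ∈ Finset.range k, (1 - a * p ^ l)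

/-- The `q`-factorial `[m]_p! = ∏_{j=1}^m (p^j - 1) / (p - 1)`. -/
def qFactorial (p : ℝ) (m : ℕ) : ℝ := ∏ j ∈ Finset.range m, (p ^ (j + 1) - 1) / (p - 1)

/-- Coefficients of `e_p(z) = ∑_k z^k / (p; p)_k`. -/
def eCoeff (p : ℝ) (k : ℕ) : ℂ := ((1 / qPoch p p k : ℝ) : ℂ)

/-- Coefficients of `E_p(z) = ∑_k p^{k(k-1)/2} z^k / (p; p)_k`. -/
def bigECoeff (p : ℝ) (k : ℕ) : ℂ := ((p ^ (k * (k - 1) / 2) / qPoch p p k : ℝ) : ℂ)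

/-- The discrete `p`-Hermite I polynomial `h_l(z; p)`, evaluated in a `ℂ`-algebra. -/
def hermiteI {A : Type*} [Ring A] [Module ℂ A] (p : ℝ) (l : ℕ) (z : A) : A :=
  ∑ k ∈ Finset.range (l / 2 + 1),
    ((qPoch p p l * ((-1) ^ k * p ^ (k * (k - 1)) /
      (qPoch (p ^ 2) (p ^ 2) k * qPoch p p (l - 2 * k))) : ℝ) : ℂ) • z ^ (l - 2 * k)

/-- The discrete `p`-Hermite II polynomial `h̃_l(z; p)`, evaluated in a `ℂ`-algebra. -/
def hermiteII {A : Type*} [Ring A] [Module ℂ A] (p : ℝ) (l : ℕ) (z : A) : A :=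
  ∑ k ∈ Finset.range (l / 2 + 1),
    ((qPoch p p l * ((-1) ^ k * p ^ (-2 * (k : ℤ) * l + k * (2 * k + 1)) /
      (qPoch (p ^ 2) (p ^ 2) k * qPoch p p (l - 2 * k))) : ℝ) : ℂ) • z ^ (l - 2 * k)

/-- The Gaussian `g_{q²}(x) = e_{q⁴}(-∑_j x_j²)`. -/
def gaussian (q : ℝ) (n : ℕ) : Cov q n :=
  evalSeries (eCoeff (q ^ 4)) (-∑ j, x q j ^ 2)

/-! ### The integral on the braided covector algebra -/

/-- `F` is an analytic continuation, to a tube `ℝⁿ + iU` around `ℝⁿ`, of the commutative power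
series `f ▷ 1 = ∑_E f_E z^E`, which converges absolutely near the origin. (The covector algebra acts
on power series in commuting `z_j` by
`x_1^{e_1} ⋯ x_n^{e_n} ▷ z^H = q^{∑_i e_i (h_1 + ⋯ + h_{i-1})} z^{H+E}`, so `x^E ▷ 1 = z^E`.) -/
def IsRealization {q : ℝ} {n : ℕ} (f : Cov q n) (F : (Fin n → ℂ) → ℂ) : Prop :=
  (∀ᶠ z in 𝓝 (0 : Fin n → ℂ), HasSum (fun E : Fin n →₀ ℕ => f.coeff E * ∏ j, z j ^ E j) (F z)) ∧
  ∃ U : Set (Fin n → ℝ), IsOpen U ∧ 0 ∈ U ∧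
    AnalyticOnNhd ℂ F {z | (fun j => (z j).im) ∈ U}

open Classical in
/-- The function `f ▷ 1` on `ℝⁿ`, by analytic continuation (`0` if there is none). -/
def realization {q : ℝ} {n : ℕ} (f : Cov q n) (z : Fin n → ℝ) : ℂ :=
  if h : ∃ F, IsRealization f F then h.choose (fun j => (z j : ℂ)) else 0

/-- `f` is integrable: `f ▷ 1` converges near `0`, continues analytically to a tube around `ℝⁿ`, and
is absolutely `q²`-Jackson integrable over every `q²`-lattice off the coordinate hyperplanes. -/
def IsIntegrable {q : ℝ} {n : ℕ} (f : Cov q n) : Prop :=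
  (∃ F, IsRealization f F) ∧
  ∀ z : Fin n → ℝ, (∀ j, z j ≠ 0) →
    Summable fun p : (Fin n → ℤ) × (Fin n → ℤˣ) =>
      q ^ (2 * ∑ j, p.1 j) * (∏ j, |z j|) *
        ‖realization f (fun j => ((p.2 j : ℤ) : ℝ) * q ^ (2 * p.1 j) * z j)‖

/-- The value at `γ` of the action on `1` of the integral
`∫_{-q^{b_n} x_n ∞}^{q^{b_n} x_n ∞} ⋯ ∫_{-q^{b_1} x_1 ∞}^{q^{b_1} x_1 ∞} f`, that is, of
`(1-q²)ⁿ ∑_{K ∈ ℤⁿ} ∑_{ε ∈ {±1}ⁿ} q^{2|K| + |b| + n(n-1)/2}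
  x_1 ⋯ x_n f(ε_1 q^{2k_1+b_1} x_1, …, ε_n q^{2k_n+b_n} x_n)`. -/
def integral {q : ℝ} {n : ℕ} (b : Fin n → ℕ) (f : Cov q n) (γ : Fin n → ℝ) : ℂ :=
  ∑' p : (Fin n → ℤ) × (Fin n → ℤˣ),
    (1 - (q : ℂ) ^ 2) ^ n *
      (q : ℂ) ^ (2 * (∑ j, p.1 j) + (∑ j, (b j : ℤ)) + (n.choose 2 : ℤ)) *
      realization
        ((List.ofFn fun j => x q j).prod *
          rescale (fun j => ((p.2 j : ℤ) : ℂ) * (q : ℂ) ^ (2 * p.1 j + (b j : ℤ))) f) γ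

/-- The projection `Π_0` on the series that are even in every variable. -/
def evenPart {q : ℝ} {n : ℕ} (f : Cov q n) : Cov q n :=
  ((2 : ℂ) ^ n)⁻¹ • ∑ ε : Fin n → ℤˣ, rescale (fun j => ((ε j : ℤ) : ℂ)) f

/-- The ordered monomial `x_1^{e_1} ⋯ x_n^{e_n}`. -/
def xMonomial (q : ℝ) {n : ℕ} (E : Fin n →₀ ℕ) : Cov q n :=
  (List.ofFn fun j => x q j ^ E j).prod

/-- The class `𝓡`: `f x^E` is `I'`-integrable for every monomial `x^E`, where `I' = I ∘ Π_0`. -/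
def ClassR {q : ℝ} {n : ℕ} (f : Cov q n) : Prop :=
  ∀ E : Fin n →₀ ℕ, IsIntegrable (evenPart (f * xMonomial q E))

/-! ### The braided antipode of the vector algebra -/

/-- The entries `R^{ij}_{ab}` of the `R`-matrix of type `A`. -/
def R (q : ℝ) {n : ℕ} (i j a b : Fin n) : ℂ :=
  if i = j then (if a = i ∧ b = j then (q : ℂ) ^ 2 else 0)
  else if a = i ∧ b = j then (q : ℂ)
  else if i < j ∧ a = j ∧ b = i then (q : ℂ) ^ 2 - 1
  else 0

/-- The braiding of a generator with a word: writing `∂_w = ∂_{w_1} ⋯ ∂_{w_k}`,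
`Φ(∂_i ⊗ ∂_w) = ∑_{w', i'} braid i w w' i' ∂_{w'} ⊗ ∂_{i'}`, where
`Φ(∂_i ⊗ ∂_j) = ∑_{a,b} R^{ij}_{ab} ∂_b ⊗ ∂_a` and `Φ (id ⊗ m) = (m ⊗ id)(id ⊗ Φ)(Φ ⊗ id)`. -/
def braid (q : ℝ) {n : ℕ} :
    (k : ℕ) → Fin n → (Fin k → Fin n) → (Fin k → Fin n) → Fin n → ℂ
  | 0, i, _, _, i' => if i = i' then 1 else 0
  | k + 1, i, w, w', i' =>
      ∑ a, R q i (w 0) a (w' 0) * braid q k a (Fin.tail w) (Fin.tail w') i'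

/-- The braided antipode on words, from `S(1) = 1`, `S(∂_i) = -∂_i` and `S m = m (S ⊗ S) Φ`. -/
def antipodeWord (q : ℝ) {n : ℕ} : (k : ℕ) → (Fin k → Fin n) → Vec q n
  | 0, _ => 1
  | k + 1, w =>
      ∑ w' : Fin k → Fin n, ∑ i' : Fin n,
        braid q k (w 0) (Fin.tail w) w' i' • (antipodeWord q k w' * (-dd q i'))

/-- The word of the basis monomial `∂_n^{e_n} ⋯ ∂_1^{e_1}`. -/
def basisWord {n : ℕ} (E : Fin n →₀ ℕ) : List (Fin n) :=
  (List.finRange n).reverse.flatMap fun j => List.replicate (E j) j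

/-- The braided antipode on formal power series. It preserves the degree, so each coefficient of the
image is a finite sum. -/
def antipode {q : ℝ} {n : ℕ} (g : Vec q n) : Vec q n :=
  ⟨fun F => ∑ E ∈ Finset.finsuppAntidiag Finset.univ F.degree,
    g.coeff E * (antipodeWord q (basisWord E).length (basisWord E).get).coeff F⟩

/-! ### The braided Fourier transform -/

/-- Coefficients of the braided exponential with rescaled second argument,
`exp(x | c_1 ∂_1, …, c_n ∂_n)
  = ∑_E x_1^{e_1} ⋯ x_n^{e_n} ⊗ ((c_n ∂_n)^{e_n} / [e_n]_{q²}!) ⋯ ((c_1 ∂_1)^{e_1} / [e_1]_{q²}!)`. -/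
def expCoeff (q : ℝ) {n : ℕ} (c : Fin n → ℂ) (E : Fin n →₀ ℕ) : ℂ :=
  ∏ j, c j ^ E j / (qFactorial (q ^ 2) (E j) : ℂ)

/-- The braided Fourier transform
`F_S = (I' ⊗ S)(m ⊗ id)(id ⊗ exp(x | (i q² / (1-q²)) (q^{n-1} ∂_1, …, q^{n-j} ∂_j, …, ∂_n)))`,
with the first tensor component realized by its action on `1`, evaluated at `γ`. -/
def fourierS {q : ℝ} {n : ℕ} (f : Cov q n) (γ : Fin n → ℝ) : Vec q n :=
  antipode ⟨fun E =>
    integral (fun _ => 0) (evenPart (f * xMonomial q E)) γ *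
      expCoeff q (fun j : Fin n =>
        Complex.I * (q : ℂ) ^ 2 / (1 - (q : ℂ) ^ 2) * (q : ℂ) ^ (n - 1 - (j : ℕ))) E⟩

/-- `e_{q⁴}(-x_1²) h̃_{a_1}(x_1; q²) ⋯ e_{q⁴}(-x_n²) h̃_{a_n}(x_n; q²)`. -/
def hermiteGaussian (q : ℝ) {n : ℕ} (a : Fin n → ℕ) : Cov q n :=
  (List.ofFn fun j =>
    evalSeries (eCoeff (q ^ 4)) (-x q j ^ 2) * hermiteII (q ^ 2) (a j) (x q j)).prod

/-- The parity shift: `B_j` is the number of odd entries among `a_1, …, a_{j-1}`. -/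
def parityShift {n : ℕ} (a : Fin n → ℕ) (j : Fin n) : ℕ :=
  ∑ k ∈ Finset.univ.filter (fun k => k < j), a k % 2

end BraidedFourier

end

noncomputable section

namespace BraidedFourier

/-! ### Ordered products and monomials in skew-commuting generators -/

namespace SkewSeries

variable {n : ℕ} {c : Fin n → Fin n → ℂ}

/-! The noncommutative statement reduces to one variable because every series involved is separable:
its coefficient at `E` is `∏_j φ_j(e_j)` (`sep`). An increasingly ordered product of one-variable
series is separable in the covector algebra. The Gaussian is separable too, by the `q⁴`-multinomial
theorem for the `x_j²` (`gaussian_eq_sep`). Right multiplication by `x^E` keeps separability and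
rescales the `j`-th variable by `q^{s_j}`, where `s_j = ∑_{k<j} e_k` (`sep_mul_xMonomial`). The
integral of a separable series is a product of one-variable bilateral Jackson sums (`integral_sep`).

In one variable, the functional equation `g(q²z) = (1+z²) g(z)` of the Gaussian and a recurrence for
the Hermite II polynomials make the weight `z^{e+1} g(z) h̃_{a+1}(z)` a `q²`-difference of the
weight for `(a, e)` (`hermiteWeight_succ`). Shifting the lattice lowers both indices. At `e = 0` the
sum telescopes to zero. Hence every moment is an explicit multiple of the Gaussian mass
(`moment_eq`), and it vanishes unless `e - a` is even and nonnegative. The mass over the lattice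
through `q^{s_j} c` depends on `s_j` only through its parity, up to a power of `q`. In the surviving
terms `e_k` and `a_k` have the same parity, which turns `s_j` into `B_j` (`moment_parity`).

On the dual side, decreasingly ordered monomials are eigenvectors of the antipode with eigenvalue
`(-1)^{|E|} q^{|E|(|E|-1)}`, because the braiding is diagonal there (`coeff_antipode`). Expanding
`|E|²` gives the squares `e_j²`, which combine with the one-variable moments (`momentRatio_mul`),
and twice the cross terms `s_j e_j`. One copy of these cancels the factor left by rescaling
`x_j^{e_j}`; the other is exactly the cost of reordering the `∂_j` increasingly. The constants
`q^{n-j}` in the exponential cancel the Jacobians `q^{-s_j}`. This proves the monomial form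
(`fourierS_hermiteGaussian`). The form with Hermite I polynomials follows from the inversion formula
`sum_hermiteI`. -/

theorem weight_eq_one {A B : Fin n →₀ ℕ} (h : ∀ i j, A i ≠ 0 → B j ≠ 0 → c i j = 1) :
    weight c A B = 1 := by
  refine Finset.prod_eq_one fun i _ => Finset.prod_eq_one fun j _ => ?_
  by_cases hA : A i = 0
  · simp [hA]
  by_cases hB : B j = 0
  · simp [hB]
  · rw [h i j hA hB, one_pow]

theorem weight_congr {c' : Fin n → Fin n → ℂ} {A B : Fin n →₀ ℕ}
    (h : ∀ i j, A i ≠ 0 → B j ≠ 0 → c i j = c' i j) : weight c A B = weight c' A B := by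
  refine Finset.prod_congr rfl fun i _ => Finset.prod_congr rfl fun j _ => ?_
  by_cases hA : A i = 0
  · simp [hA]
  by_cases hB : B j = 0
  · simp [hB]
  · rw [h i j hA hB]

theorem coeff_sum {ι : Type*} (s : Finset ι) (f : ι → SkewSeries c) (E : Fin n →₀ ℕ) :
    (∑ i ∈ s, f i).coeff E = ∑ i ∈ s, (f i).coeff E := by
  classical
  induction s using Finset.induction_on with
  | empty => simp [coeff_zero]
  | insert a s ha ih => rw [Finset.sum_insert ha, Finset.sum_insert ha, coeff_add, ih]

theorem smul_mul_left (r : ℂ) (f g : SkewSeries c) : (r • f) * g = r • (f * g) := by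
  ext E
  simp only [coeff_mul, coeff_smul, Finset.mul_sum]
  exact Finset.sum_congr rfl fun p _ => by ring

theorem mul_smul_right (r : ℂ) (f g : SkewSeries c) : f * (r • g) = r • (f * g) := by
  ext E
  simp only [coeff_mul, coeff_smul, Finset.mul_sum]
  exact Finset.sum_congr rfl fun p _ => by ring

/-- The ring of power series in the single generator `u_j`. -/
def embed (c : Fin n → Fin n → ℂ) (j : Fin n) (hj : c j j = 1) :
    PowerSeries ℂ →+* SkewSeries c where
  toFun φ := ⟨fun E => if E = Finsupp.single j (E j) then PowerSeries.coeff (E j) φ else 0⟩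
  map_one' := by
    ext E
    simp only [coeff_one, PowerSeries.coeff_one]
    by_cases h : E = 0
    · simp [h]
    · by_cases h' : E = Finsupp.single j (E j)
      · have : E j ≠ 0 := fun h0 => h (by rw [h', h0, Finsupp.single_zero])
        simp [h, this]
      · simp [h, h']
  map_mul' φ ψ := by
    ext E
    simp only [coeff_mul]
    split_ifs with h
    · rw [h, Finsupp.antidiagonal_single, Finset.sum_map, Finsupp.single_eq_same,
        PowerSeries.coeff_mul]
      refine Finset.sum_congr rfl fun p _ => ?_
      have hw : weight c (Finsupp.single j p.1) (Finsupp.single j p.2) = 1 := by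
        refine weight_eq_one fun i k hi hk => ?_
        rw [Finsupp.single_apply] at hi hk
        obtain rfl : j = i := by by_contra h; simp [h] at hi
        obtain rfl : j = k := by by_contra h; simp [h] at hk
        exact hj
      simp [hw]
    · symm
      refine Finset.sum_eq_zero fun p hp => ?_
      rw [Finset.HasAntidiagonal.mem_antidiagonal] at hp
      by_cases h1 : p.1 = Finsupp.single j (p.1 j)
      · by_cases h2 : p.2 = Finsupp.single j (p.2 j)
        · exfalso
          apply h
          rw [← hp, Finsupp.add_apply, Finsupp.single_add, ← h1, ← h2]
        · simp [h2]
      · simp [h1]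
  map_zero' := by ext E; simp [coeff_zero]
  map_add' φ ψ := by
    ext E
    simp only [coeff_add]
    split_ifs <;> simp

theorem coeff_embed (j : Fin n) (hj : c j j = 1) (φ : PowerSeries ℂ) (E : Fin n →₀ ℕ) :
    (embed c j hj φ).coeff E =
      if E = Finsupp.single j (E j) then PowerSeries.coeff (E j) φ else 0 := rfl

theorem embed_smul (j : Fin n) (hj : c j j = 1) (r : ℂ) (φ : PowerSeries ℂ) :
    embed c j hj (r • φ) = r • embed c j hj φ := by
  ext E
  simp only [coeff_embed, coeff_smul]
  split_ifs <;> simp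

theorem embed_X (j : Fin n) (hj : c j j = 1) : embed c j hj PowerSeries.X = gen c j := by
  ext E
  simp only [coeff_embed, gen, PowerSeries.coeff_X]
  by_cases h : E = Finsupp.single j 1
  · simp [h]
  · by_cases h' : E = Finsupp.single j (E j)
    · have : E j ≠ 1 := fun h1 => h (by rw [h', h1])
      simp [h, this]
    · simp [h, h']

theorem evalSeries_embed (j : Fin n) (hj : c j j = 1) (f : ℕ → ℂ) (u : PowerSeries ℂ) :
    evalSeries f (embed c j hj u) = embed c j hj (PowerSeries.mk fun m =>
      ∑ k ∈ Finset.range (m + 1), f k * PowerSeries.coeff m (u ^ k)) := by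
  ext E
  simp only [evalSeries, ← map_pow, coeff_embed]
  split_ifs with h
  · have : E.degree = E j := by rw [h]; simp
    simp [this]
  · simp

/-- The reordering factor between increasingly ordered monomials and the basis monomials. -/
def orderWeight (c : Fin n → Fin n → ℂ) (E : Fin n →₀ ℕ) : ℂ :=
  weight (fun i k => if i < k then c i k else 1) E E

/-- The first factor contributes only powers of `u_j`, and the remaining factors contain no `u_j`.
So `E` splits in exactly one way, and merging the two parts collects `c j k` for the later `k` only.
-/
theorem coeff_list_prod_embed (hc : ∀ j, c j j = 1) (φ : Fin n → PowerSeries ℂ)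
    (l : List (Fin n)) (hl : l.Pairwise (· < ·)) (E : Fin n →₀ ℕ) :
    (l.map fun j => embed c j (hc j) (φ j)).prod.coeff E =
      if ∀ j, j ∉ l → E j = 0 then
        (l.map fun j => PowerSeries.coeff (E j) (φ j)).prod * orderWeight c E else 0 := by
  classical
  induction l generalizing E with
  | nil =>
    have : (∀ j, E j = 0) ↔ E = 0 := by simp [Finsupp.ext_iff]
    by_cases h : E = 0
    · simp [h, coeff_one, orderWeight, weight_zero_left]
    · simp [h, coeff_one, this]
  | cons j l ih =>
    obtain ⟨hjl, hl⟩ := List.pairwise_cons.1 hl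
    have hj : j ∉ l := fun h => lt_irrefl _ (hjl j h)
    rw [List.map_cons, List.prod_cons, coeff_mul,
      Finset.sum_eq_single (Finsupp.single j (E j), E.erase j)]
    · rw [ih hl, coeff_embed]
      simp only [Finsupp.single_eq_same, if_true]
      have hiff : (∀ k, k ∉ l → E.erase j k = 0) ↔ ∀ k, k ∉ j :: l → E k = 0 := by
        refine forall_congr' fun k => ?_
        by_cases hk : k = j
        · simp [hk]
        · simp [hk]
      simp only [hiff]
      split_ifs with h
      · have hmap : (l.map fun k => PowerSeries.coeff (E.erase j k) (φ k)) =
            l.map fun k => PowerSeries.coeff (E k) (φ k) :=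
          List.map_congr_left fun k hk => by
            have hkj : k ≠ j := by
              rintro rfl
              exact hj hk
            rw [Finsupp.erase_ne hkj]
        have hB : ∀ k, E.erase j k ≠ 0 → j < k := by
          intro k hk
          by_cases hkj : k = j
          · simp [hkj] at hk
          · rw [Finsupp.erase_ne hkj] at hk
            by_contra hlt
            exact hk (h k (by
              rw [List.mem_cons, not_or]
              exact ⟨hkj, fun hm => hlt (hjl k hm)⟩))
        have hA : ∀ k, Finsupp.single j (E j) k ≠ 0 → k = j := by
          intro k hk
          by_contra hkj
          simp [Finsupp.single_eq_of_ne hkj] at hk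
        have hE : orderWeight c E = weight c (Finsupp.single j (E j)) (E.erase j) *
            orderWeight c (E.erase j) := by
          conv_lhs => rw [← Finsupp.single_add_erase j E]
          unfold orderWeight
          rw [weight_add_left, weight_add_right, weight_add_right]
          rw [weight_eq_one (A := Finsupp.single j (E j)) (B := Finsupp.single j (E j))
              (fun i k hi hk => by rw [hA i hi, hA k hk]; simp),
            weight_eq_one (A := E.erase j) (B := Finsupp.single j (E j))
              (fun i k hi hk => by rw [hA k hk]; simp [(hB i hi).not_gt]),
            weight_congr (c' := c) (A := Finsupp.single j (E j)) (B := E.erase j)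
              (fun i k hi hk => by rw [hA i hi]; simp [hB k hk]),
            _root_.one_mul, _root_.one_mul]
        rw [hE, hmap, List.map_cons, List.prod_cons]
        ring
      · simp
    · rintro ⟨A, B⟩ hAB hne
      rw [Finset.HasAntidiagonal.mem_antidiagonal] at hAB
      dsimp only at hAB ⊢
      rw [ih hl, coeff_embed]
      split_ifs with h1 h2
      · exfalso
        apply hne
        have hAj : A j = E j := by rw [← hAB, Finsupp.add_apply, h2 j hj, add_zero]
        have hA : A = Finsupp.single j (E j) := by rw [← hAj, ← h1]
        refine Prod.ext hA ?_
        ext k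
        by_cases hk : k = j
        · subst hk
          simpa using h2 k hj
        · rw [Finsupp.erase_ne hk, ← hAB, Finsupp.add_apply, hA, Finsupp.single_eq_of_ne hk,
            zero_add]
      · simp
      · simp
      · simp
    · intro h
      exact absurd (by rw [Finset.HasAntidiagonal.mem_antidiagonal, Finsupp.single_add_erase]) h

/-- Coefficients of an increasingly ordered product of one-variable series. -/
theorem coeff_prod_embed (hc : ∀ j, c j j = 1) (φ : Fin n → PowerSeries ℂ) (E : Fin n →₀ ℕ) :
    (List.ofFn fun j => embed c j (hc j) (φ j)).prod.coeff E =
      (∏ j, PowerSeries.coeff (E j) (φ j)) * orderWeight c E := by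
  rw [List.ofFn_eq_map, coeff_list_prod_embed hc φ _ (List.pairwise_lt_finRange n),
    if_pos (fun j hj => absurd (List.mem_finRange j) hj), ← List.ofFn_eq_map, List.prod_ofFn]

theorem coeff_monomial_mul {u : SkewSeries c} {A : Fin n →₀ ℕ}
    (hu : ∀ F, u.coeff F = if F = A then 1 else 0) (f : SkewSeries c) (E : Fin n →₀ ℕ) :
    (u * f).coeff E = if A ≤ E then weight c A (E - A) * f.coeff (E - A) else 0 := by
  rw [coeff_mul]
  split_ifs with h
  · rw [Finset.sum_eq_single (A, E - A)]
    · simp [hu]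
    · rintro ⟨A', B⟩ hAB hne
      rw [Finset.HasAntidiagonal.mem_antidiagonal] at hAB
      dsimp only at hAB ⊢
      rw [hu, if_neg]
      · simp
      · rintro rfl
        exact hne (by rw [← hAB, add_tsub_cancel_left])
    · intro h'
      exact absurd (by rw [Finset.HasAntidiagonal.mem_antidiagonal, add_tsub_cancel_of_le h]) h'
  · refine Finset.sum_eq_zero ?_
    rintro ⟨A', B⟩ hAB
    rw [Finset.HasAntidiagonal.mem_antidiagonal] at hAB
    dsimp only at hAB ⊢
    rw [hu, if_neg]
    · simp
    · rintro rfl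
      exact h (by rw [← hAB]; exact le_self_add)

theorem coeff_mul_monomial {u : SkewSeries c} {B : Fin n →₀ ℕ}
    (hu : ∀ F, u.coeff F = if F = B then 1 else 0) (f : SkewSeries c) (E : Fin n →₀ ℕ) :
    (f * u).coeff E = if B ≤ E then weight c (E - B) B * f.coeff (E - B) else 0 := by
  rw [coeff_mul]
  split_ifs with h
  · rw [Finset.sum_eq_single (E - B, B)]
    · simp [hu]
    · rintro ⟨A, B'⟩ hAB hne
      rw [Finset.HasAntidiagonal.mem_antidiagonal] at hAB
      dsimp only at hAB ⊢
      rw [hu, if_neg]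
      · simp
      · rintro rfl
        exact hne (by rw [← hAB, add_tsub_cancel_right])
    · intro h'
      exact absurd (by rw [Finset.HasAntidiagonal.mem_antidiagonal, tsub_add_cancel_of_le h]) h'
  · refine Finset.sum_eq_zero ?_
    rintro ⟨A, B'⟩ hAB
    rw [Finset.HasAntidiagonal.mem_antidiagonal] at hAB
    dsimp only at hAB ⊢
    rw [hu, if_neg]
    · simp
    · rintro rfl
      exact h (by rw [← hAB]; exact le_add_self)

/-- The series with coefficients `∏_j φ_j(e_j)`. -/
def sep (c : Fin n → Fin n → ℂ) (φ : Fin n → PowerSeries ℂ) : SkewSeries c :=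
  ⟨fun E => ∏ j, PowerSeries.coeff (E j) (φ j)⟩

theorem coeff_sep (φ : Fin n → PowerSeries ℂ) (E : Fin n →₀ ℕ) :
    (sep c φ).coeff E = ∏ j, PowerSeries.coeff (E j) (φ j) := rfl

theorem rescale_sep (r : Fin n → ℂ) (φ : Fin n → PowerSeries ℂ) :
    rescale r (sep c φ) = sep c fun j => PowerSeries.rescale (r j) (φ j) := by
  ext E
  simp [rescale, coeff_sep, PowerSeries.coeff_rescale, Finset.prod_mul_distrib]

end SkewSeries

/-! ### Separable series in the covector algebra -/

open SkewSeries

variable {q : ℝ} {n : ℕ}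

theorem cov_diag (q : ℝ) (j : Fin n) : (if j < j then (q : ℂ) else 1) = 1 := by simp

theorem cov_orderWeight (E : Fin n →₀ ℕ) :
    orderWeight (fun i j : Fin n => if j < i then (q : ℂ) else 1) E = 1 :=
  weight_eq_one fun i j _ _ => by
    by_cases h : i < j
    · simp [h, h.not_gt]
    · simp [h]

theorem cov_prod_embed (φ : Fin n → PowerSeries ℂ) :
    (List.ofFn fun j => embed (fun i j : Fin n => if j < i then (q : ℂ) else 1) j
      (cov_diag q j) (φ j)).prod = (sep _ φ : Cov q n) := by
  ext E
  rw [coeff_prod_embed (cov_diag q), cov_orderWeight, mul_one, coeff_sep]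

theorem xMonomial_eq (E : Fin n →₀ ℕ) :
    xMonomial q E = (sep _ fun j => PowerSeries.X ^ E j : Cov q n) := by
  rw [← cov_prod_embed]
  simp only [map_pow, embed_X]
  rfl

theorem coeff_xMonomial (E F : Fin n →₀ ℕ) :
    (xMonomial q E).coeff F = if F = E then 1 else 0 := by
  rw [xMonomial_eq, coeff_sep]
  simp only [PowerSeries.coeff_X_pow]
  rw [Finset.prod_ite_zero]
  simp [Finsupp.ext_iff]

theorem weight_cov (A B : Fin n →₀ ℕ) :
    weight (fun i j : Fin n => if j < i then (q : ℂ) else 1) A B =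
      ∏ i, ((q : ℂ) ^ (∑ j ∈ Finset.univ.filter (· < i), B j)) ^ A i := by
  refine Finset.prod_congr rfl fun i _ => ?_
  rw [← Finset.prod_pow_eq_pow_sum, ← Finset.prod_pow, Finset.prod_filter]
  refine Finset.prod_congr rfl fun j _ => ?_
  by_cases h : j < i
  · simp only [h, if_true]
    rw [← pow_mul, mul_comm]
  · simp [h]

/-- Each `x_j` of the left factor must pass the `x_k` with `k < j` of the monomial, at the cost of
one `q` per letter. The cost is geometric in the exponent of `x_j`, hence a rescaling of the `j`-th
factor. -/
theorem sep_mul_xMonomial (φ : Fin n → PowerSeries ℂ) (E : Fin n →₀ ℕ) :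
    (sep _ φ : Cov q n) * xMonomial q E = sep _ fun j =>
      PowerSeries.rescale ((q : ℂ) ^ (∑ k ∈ Finset.univ.filter (· < j), E k)) (φ j) *
        PowerSeries.X ^ E j := by
  ext F
  rw [coeff_mul_monomial (coeff_xMonomial E)]
  simp only [coeff_sep, PowerSeries.coeff_mul_X_pow', PowerSeries.coeff_rescale]
  split_ifs with h
  · rw [weight_cov, ← Finset.prod_mul_distrib]
    exact Finset.prod_congr rfl fun j _ => by rw [if_pos (h j)]; rfl
  · obtain ⟨j, hj⟩ : ∃ j, ¬ E j ≤ F j := by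
      by_contra! h'
      exact h h'
    exact (Finset.prod_eq_zero (Finset.mem_univ j) (if_neg hj)).symm

/-- Every `x_i` with `i > j` passes `x_j`; counting indices from `0`, there are `n - 1 - j` of them.
-/
theorem prod_x_mul_sep (φ : Fin n → PowerSeries ℂ) :
    (List.ofFn fun j => x q j).prod * (sep _ φ : Cov q n) = sep _ fun j =>
      PowerSeries.rescale ((q : ℂ) ^ (n - 1 - (j : ℕ))) (φ j) * PowerSeries.X := by
  set E : Fin n →₀ ℕ := Finsupp.equivFunOnFinite.symm fun _ => 1 with hE
  have hE1 : ∀ j, E j = 1 := fun j => by simp [hE]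
  have hx : (List.ofFn fun j : Fin n => x q j).prod = xMonomial q E := by
    simp [xMonomial, hE1]
  have hX : ∀ ψ : PowerSeries ℂ, ψ * PowerSeries.X = ψ * PowerSeries.X ^ 1 := fun ψ => by
    rw [pow_one]
  ext F
  rw [hx, coeff_monomial_mul (coeff_xMonomial E)]
  simp only [coeff_sep, hX, PowerSeries.coeff_mul_X_pow', PowerSeries.coeff_rescale]
  split_ifs with h
  · have hw : weight (fun i j : Fin n => if j < i then (q : ℂ) else 1) E (F - E) =
        ∏ j : Fin n, ((q : ℂ) ^ (n - 1 - (j : ℕ))) ^ (F j - 1) := by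
      unfold weight
      rw [Finset.prod_comm]
      refine Finset.prod_congr rfl fun j _ => ?_
      have : ∀ i : Fin n, (if j < i then (q : ℂ) else 1) ^ (E i * (F - E) j) =
          if j < i then (q : ℂ) ^ (F j - 1) else 1 := fun i => by
        rw [hE1, Finsupp.tsub_apply, hE1, one_mul]
        split_ifs <;> simp
      simp only [this]
      rw [← Finset.prod_filter, Finset.prod_const, ← pow_mul, ← pow_mul, mul_comm]
      congr 2
      have : (Finset.univ.filter fun i : Fin n => j < i) = Finset.Ioi j := by ext; simp
      rw [this, Fin.card_Ioi]
    rw [hw, ← Finset.prod_mul_distrib]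
    refine Finset.prod_congr rfl fun j _ => ?_
    have := h j
    rw [hE1] at this
    rw [if_pos this, Finsupp.tsub_apply, hE1]
  · obtain ⟨j, hj⟩ : ∃ j, ¬ E j ≤ F j := by
      by_contra! h'
      exact h h'
    rw [hE1] at hj
    exact (Finset.prod_eq_zero (Finset.mem_univ j) (if_neg hj)).symm

/-- The even part of a power series. -/
def evenPS (φ : PowerSeries ℂ) : PowerSeries ℂ :=
  (2 : ℂ)⁻¹ • (φ + PowerSeries.rescale (-1) φ)

/-- The average over `{±1}ⁿ` is a product of averages over `{±1}`. -/
theorem evenPart_sep (φ : Fin n → PowerSeries ℂ) :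
    evenPart (sep _ φ : Cov q n) = sep _ fun j => evenPS (φ j) := by
  ext F
  simp only [evenPart, coeff_smul, coeff_sum, SkewSeries.rescale, coeff_sep, evenPS,
    PowerSeries.coeff_smul, map_add, PowerSeries.coeff_rescale]
  rw [← Finset.sum_mul]
  have h := Finset.prod_univ_sum (fun _ : Fin n => (Finset.univ : Finset ℤˣ))
    (fun j u => (((u : ℤ) : ℂ)) ^ F j)
  rw [Fintype.piFinset_univ] at h
  rw [← h, Finset.prod_congr rfl fun j _ => show ∑ u : ℤˣ, (((u : ℤ) : ℂ)) ^ F j =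
      1 + (-1) ^ F j by
    rw [UnitsInt.univ, Finset.sum_pair (by decide)]; simp]
  have h2 : ((2 : ℂ) ^ n)⁻¹ = ∏ _j : Fin n, (2 : ℂ)⁻¹ := by simp
  rw [h2, ← Finset.prod_mul_distrib, ← Finset.prod_mul_distrib]
  refine Finset.prod_congr rfl fun j _ => ?_
  simp only [smul_eq_mul]
  ring

/-! ### The braided antipode on ordered monomials -/

/-- The off-diagonal entry `q² - 1` occurs only for `i < j`, so here the braiding is a flip times a
scalar. -/
theorem R_of_ge {i j : Fin n} (h : j ≤ i) (a b : Fin n) :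
    R q i j a b = if a = i ∧ b = j then (q : ℂ) * (if j = i then (q : ℂ) else 1) else 0 := by
  unfold R
  by_cases hij : i = j
  · subst hij
    simp [pow_two]
  · have : ¬ i < j := h.not_gt
    simp [hij, this, Ne.symm hij]

/-- The braiding is diagonal on words whose letters do not exceed the generator. -/
theorem braid_of_ge (k : ℕ) (i : Fin n) (w : Fin k → Fin n) (hw : ∀ j, w j ≤ i)
    (w' : Fin k → Fin n) (i' : Fin n) :
    braid q k i w w' i' =
      if w' = w ∧ i' = i then ∏ j, ((q : ℂ) * (if w j = i then (q : ℂ) else 1)) else 0 := by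
  induction k with
  | zero =>
    have : w' = w := Subsingleton.elim _ _
    simp [braid, this, eq_comm]
  | succ k ih =>
    rw [braid, Finset.sum_eq_single i]
    · rw [ih (Fin.tail w) (fun j => hw j.succ) (Fin.tail w'), R_of_ge (hw 0)]
      have hiff : w' = w ↔ w' 0 = w 0 ∧ Fin.tail w' = Fin.tail w := by
        constructor
        · rintro rfl
          exact ⟨rfl, rfl⟩
        · rintro ⟨h0, h1⟩
          rw [← Fin.cons_self_tail w', ← Fin.cons_self_tail w, h0, h1]
      simp only [hiff, true_and]
      by_cases h0 : w' 0 = w 0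
      · by_cases h1 : Fin.tail w' = Fin.tail w ∧ i' = i
        · rw [if_pos h0, if_pos h1]
          refine Eq.trans ?_ (if_pos ⟨⟨h0, h1.1⟩, h1.2⟩).symm
          rw [Fin.prod_univ_succ]
          rfl
        · rw [if_neg h1, mul_zero]
          exact (if_neg (fun h => h1 ⟨h.1.2, h.2⟩)).symm
      · rw [if_neg h0, zero_mul]
        exact (if_neg (fun h => h0 h.1.1)).symm
    · intro a _ ha
      rw [R_of_ge (hw 0)]
      simp [ha]
    · simp

/-- Moving the largest letter `w 0` to the end costs `q` for each letter passed and another `q` if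
that letter equals `w 0`. Restoring the decreasing order of the result costs `q` precisely for the
letters different from `w 0`. Each pair therefore contributes `q²` in either case, and the total is
`q^{k(k-1)}`. -/
theorem coeff_antipodeWord (k : ℕ) (w : Fin k → Fin n) (hw : Antitone w) (F : Fin n →₀ ℕ) :
    (antipodeWord q k w).coeff F =
      if F = ∑ j, Finsupp.single (w j) 1 then (-1) ^ k * (q : ℂ) ^ (k * (k - 1)) else 0 := by
  induction k generalizing F with
  | zero => simp [antipodeWord, coeff_one]
  | succ k ih =>
    have hge : ∀ j, Fin.tail w j ≤ w 0 := fun j => hw (Fin.zero_le _)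
    have htail : Antitone (Fin.tail w) := fun i j hij => hw (Fin.succ_le_succ_iff.2 hij)
    have hword : antipodeWord q (k + 1) w =
        (∏ j, ((q : ℂ) * (if Fin.tail w j = w 0 then (q : ℂ) else 1))) •
          (antipodeWord q k (Fin.tail w) * -dd q (w 0)) := by
      rw [antipodeWord, Finset.sum_eq_single (Fin.tail w), Finset.sum_eq_single (w 0)]
      · rw [braid_of_ge k _ _ hge, if_pos ⟨rfl, rfl⟩]
      · intro i' _ hi'
        rw [braid_of_ge k _ _ hge, if_neg (fun h => hi' h.2), zero_smul]
      · simp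
      · intro w' _ hw'
        refine Finset.sum_eq_zero fun i' _ => ?_
        rw [braid_of_ge k _ _ hge, if_neg (fun h => hw' h.1), zero_smul]
      · simp
    set G : Fin n →₀ ℕ := ∑ j, Finsupp.single (Fin.tail w j) 1 with hG
    have hsum : ∑ j, Finsupp.single (w j) 1 = G + Finsupp.single (w 0) 1 := by
      rw [Fin.sum_univ_succ, add_comm]
      rfl
    have hweight : weight (fun i j : Fin n => if i < j then (q : ℂ) else 1) G
        (Finsupp.single (w 0) 1) = ∏ j, (if Fin.tail w j = w 0 then 1 else (q : ℂ)) := by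
      have hfac : ∀ (s : Finset (Fin k)),
          weight (fun i j : Fin n => if i < j then (q : ℂ) else 1)
            (∑ j ∈ s, Finsupp.single (Fin.tail w j) 1) (Finsupp.single (w 0) 1) =
          ∏ j ∈ s, (if Fin.tail w j = w 0 then 1 else (q : ℂ)) := by
        classical
        intro s
        induction s using Finset.induction_on with
        | empty => simp [weight_zero_left]
        | insert a s ha ih =>
          rw [Finset.sum_insert ha, Finset.prod_insert ha, weight_add_left, ih]
          congr 1
          unfold weight
          rw [Finset.prod_eq_single (Fin.tail w a), Finset.prod_eq_single (w 0)]
          · by_cases h : Fin.tail w a = w 0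
            · simp [h]
            · simp [h, lt_of_le_of_ne (hge a) h]
          · intro b _ hb
            simp [Finsupp.single_eq_of_ne hb]
          · simp
          · intro b _ hb
            simp [Finsupp.single_eq_of_ne hb]
          · simp
      exact hfac Finset.univ
    rw [hword, coeff_smul, coeff_mul, hsum]
    by_cases hF : F = G + Finsupp.single (w 0) 1
    · rw [if_pos hF, Finset.sum_eq_single (G, Finsupp.single (w 0) 1)]
      · rw [ih _ htail, if_pos rfl, hweight, coeff_neg]
        simp only [dd, gen, if_true]
        have hprod : (∏ j, ((q : ℂ) * (if Fin.tail w j = w 0 then (q : ℂ) else 1))) *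
            ∏ j, (if Fin.tail w j = w 0 then 1 else (q : ℂ)) = q ^ (2 * k) := by
          rw [← Finset.prod_mul_distrib, Finset.prod_congr rfl fun j _ => show
            (q : ℂ) * (if Fin.tail w j = w 0 then (q : ℂ) else 1) *
              (if Fin.tail w j = w 0 then 1 else (q : ℂ)) = q ^ 2 by split_ifs <;> ring]
          rw [Finset.prod_const, Finset.card_univ, Fintype.card_fin, pow_mul]
        rw [← mul_assoc, hprod]
        have hexp : 2 * k + k * (k - 1) = (k + 1) * (k + 1 - 1) := by
          cases k
          · rfl
          · simp only [Nat.add_sub_cancel]; ring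
        rw [← hexp, pow_add, pow_succ]
        ring
      · rintro ⟨A, B⟩ hAB hne
        dsimp only
        rw [ih _ htail]
        split_ifs with hA
        · rw [coeff_neg]
          simp only [dd, gen]
          rw [if_neg]
          · simp
          · intro hB
            exact hne (by rw [hA, hB])
        · simp
      · intro h
        exact absurd (by rw [Finset.HasAntidiagonal.mem_antidiagonal, hF]) h
    · rw [if_neg hF, Finset.sum_eq_zero, mul_zero]
      rintro ⟨A, B⟩ hAB
      rw [Finset.HasAntidiagonal.mem_antidiagonal] at hAB
      dsimp only at hAB ⊢
      rw [ih _ htail]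
      split_ifs with hA
      · rw [coeff_neg]
        simp only [dd, gen]
        rw [if_neg]
        · simp
        · intro hB
          exact hF (by rw [← hAB, hA, hB])
      · simp

theorem basisWord_sum (E : Fin n →₀ ℕ) :
    ((basisWord E).map fun j => Finsupp.single j 1).sum = E := by
  have h : ∀ l : List (Fin n), ((l.flatMap fun j => List.replicate (E j) j).map
      fun j => (Finsupp.single j 1 : Fin n →₀ ℕ)).sum =
      (l.map fun j => Finsupp.single j (E j)).sum := by
    intro l
    induction l with
    | nil => simp
    | cons j l ih =>
      rw [List.flatMap_cons, List.map_append, List.sum_append, ih]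
      simp
  rw [basisWord, h, List.map_reverse, List.sum_reverse, ← List.ofFn_eq_map, List.sum_ofFn]
  exact Finsupp.univ_sum_single E

theorem basisWord_antitone (E : Fin n →₀ ℕ) : Antitone (basisWord E).get := by
  have h : (basisWord E).Pairwise (· ≥ ·) := by
    rw [basisWord, List.pairwise_flatMap]
    refine ⟨fun j _ => List.pairwise_replicate.2 (Or.inr le_rfl), ?_⟩
    rw [List.pairwise_reverse]
    refine (List.pairwise_lt_finRange n).imp ?_
    intro a b hab x hx y hy
    rw [List.eq_of_mem_replicate hx, List.eq_of_mem_replicate hy]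
    exact hab.le
  intro i j hij
  rcases hij.eq_or_lt with rfl | hlt
  · exact le_rfl
  · exact List.pairwise_iff_get.1 h i j hlt

theorem basisWord_length (E : Fin n →₀ ℕ) : (basisWord E).length = E.degree := by
  have h := congrArg Finsupp.degree (basisWord_sum E)
  rw [← h, map_list_sum, List.map_map, List.map_congr_left (g := fun _ => 1) (by simp)]
  simp

/-- Basis words are decreasing, so the antipode is diagonal in the basis, with an eigenvalue that
depends only on the degree. -/
theorem coeff_antipode (g : Vec q n) (F : Fin n →₀ ℕ) :
    (antipode g).coeff F =
      g.coeff F * ((-1) ^ F.degree * (q : ℂ) ^ (F.degree * (F.degree - 1))) := by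
  have hw : ∀ E : Fin n →₀ ℕ, ∑ j, Finsupp.single ((basisWord E).get j) 1 = E := by
    intro E
    conv_rhs => rw [← basisWord_sum E]
    rw [← List.sum_ofFn]
    congr 1
    conv_rhs => rw [← List.ofFn_get (basisWord E), List.map_ofFn]
    rfl
  simp only [antipode, coeff_antipodeWord _ _ (basisWord_antitone _), hw]
  rw [Finset.sum_eq_single F]
  · rw [if_pos rfl, basisWord_length]
  · intro E _ hE
    rw [if_neg hE.symm, mul_zero]
  · intro h
    exfalso
    apply h
    rw [Finset.mem_finsuppAntidiag]
    exact ⟨by rw [Finsupp.degree_eq_sum], Finset.subset_univ _⟩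

/-! ### `q`-series -/

theorem qPoch_succ (a p : ℝ) (k : ℕ) : qPoch a p (k + 1) = qPoch a p k * (1 - a * p ^ k) :=
  Finset.prod_range_succ _ _

theorem qPoch_self_succ (p : ℝ) (k : ℕ) :
    qPoch p p (k + 1) = qPoch p p k * (1 - p ^ (k + 1)) := by
  rw [qPoch_succ, pow_succ' p k]

theorem qPoch_self_pos {p : ℝ} (h0 : 0 < p) (h1 : p < 1) (k : ℕ) : 0 < qPoch p p k := by
  refine Finset.prod_pos fun l _ => ?_
  rw [← pow_succ', sub_pos]
  exact pow_lt_one₀ h0.le h1 (Nat.succ_ne_zero l)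

theorem qPoch_self_ne_zero {p : ℝ} (h0 : 0 < p) (h1 : p < 1) (k : ℕ) : qPoch p p k ≠ 0 :=
  (qPoch_self_pos h0 h1 k).ne'

/-- `∑_{k ≤ m} (-1)^k p^{k(k-1)/2} / ((p;p)_k (p;p)_{m-k}) = 0` for `m > 0`. -/
theorem sum_qPoch_inverse {p : ℝ} (h0 : 0 < p) (h1 : p < 1) (m : ℕ) :
    ∑ k ∈ Finset.range (m + 1),
      (-1) ^ k * p ^ (k * (k - 1) / 2) / (qPoch p p k * qPoch p p (m - k)) =
      if m = 0 then 1 else 0 := by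
  have hne := qPoch_self_ne_zero h0 h1
  induction m with
  | zero => simp [qPoch]
  | succ m ih =>
    have hm : (1 : ℝ) - p ^ (m + 1) ≠ 0 :=
      (sub_pos.2 (pow_lt_one₀ h0.le h1 (Nat.succ_ne_zero m))).ne'
    rw [if_neg (Nat.succ_ne_zero m)]
    -- Split `1 - p^{m+1} = (1 - p^{m+1-k}) + p^{m+1-k}(1 - p^k)`. Each summand cancels the last
    -- factor of one shifted factorial; after shifting `k` in the second sum, the two combine
    -- termwise to `1 - p^m` times the sum for `m`. For `m = 0` this prefactor vanishes.
    have key : (1 - p ^ (m + 1)) * ∑ k ∈ Finset.range (m + 1 + 1),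
        (-1) ^ k * p ^ (k * (k - 1) / 2) / (qPoch p p k * qPoch p p (m + 1 - k)) =
        (1 - p ^ m) * ∑ k ∈ Finset.range (m + 1),
          (-1) ^ k * p ^ (k * (k - 1) / 2) / (qPoch p p k * qPoch p p (m - k)) := by
      have hsplit : ∀ k ∈ Finset.range (m + 1 + 1),
          (1 - p ^ (m + 1)) * ((-1) ^ k * p ^ (k * (k - 1) / 2) /
            (qPoch p p k * qPoch p p (m + 1 - k))) =
          (1 - p ^ (m + 1 - k)) * ((-1) ^ k * p ^ (k * (k - 1) / 2) /
            (qPoch p p k * qPoch p p (m + 1 - k))) +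
          p ^ (m + 1 - k) * (1 - p ^ k) * ((-1) ^ k * p ^ (k * (k - 1) / 2) /
            (qPoch p p k * qPoch p p (m + 1 - k))) := by
        intro k hk
        have : p ^ (m + 1) = p ^ (m + 1 - k) * p ^ k := by
          rw [← pow_add, Nat.sub_add_cancel (Nat.lt_succ_iff.1 (Finset.mem_range.1 hk))]
        rw [this]
        ring
      rw [Finset.mul_sum, Finset.sum_congr rfl hsplit, Finset.sum_add_distrib,
        Finset.sum_range_succ, Finset.sum_range_succ' _ (m + 1)]
      simp only [Nat.sub_self, pow_zero, sub_self, mul_zero, zero_mul, add_zero]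
      rw [Finset.mul_sum, ← Finset.sum_add_distrib]
      refine Finset.sum_congr rfl fun k hk => ?_
      have hk' : k ≤ m := Nat.lt_succ_iff.1 (Finset.mem_range.1 hk)
      obtain ⟨d, rfl⟩ := Nat.exists_eq_add_of_le hk'
      have e1 : k + d + 1 - k = d + 1 := by omega
      have e2 : k + d + 1 - (k + 1) = d := by omega
      have e3 : k + d - k = d := by omega
      have e4 : (k + 1) * (k + 1 - 1) / 2 = k + k * (k - 1) / 2 := by
        rw [Nat.add_sub_cancel, show (k + 1) * k = k * (k - 1) + 2 * k by
          cases k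
          · rfl
          · simp only [Nat.add_sub_cancel]; ring]
        omega
      rw [e1, e2, e3, e4, qPoch_self_succ p d, qPoch_self_succ p k]
      have hd : (1 : ℝ) - p ^ (d + 1) ≠ 0 :=
        (sub_pos.2 (pow_lt_one₀ h0.le h1 (Nat.succ_ne_zero d))).ne'
      have hk1 : (1 : ℝ) - p ^ (k + 1) ≠ 0 :=
        (sub_pos.2 (pow_lt_one₀ h0.le h1 (Nat.succ_ne_zero k))).ne'
      have := hne k
      have := hne d
      field_simp
      ring
    rw [ih] at key
    rcases Nat.eq_zero_or_pos m with rfl | hpos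
    · rw [pow_zero, sub_self, zero_mul] at key
      exact (mul_eq_zero.1 key).resolve_left hm
    · rw [if_neg hpos.ne', mul_zero] at key
      exact (mul_eq_zero.1 key).resolve_left hm

/-- Monomials in terms of the discrete Hermite I polynomials. -/
theorem sum_hermiteI {A : Type*} [Ring A] [Module ℂ A] {p : ℝ} (h0 : 0 < p) (h1 : p < 1)
    (a : ℕ) (z : A) :
    ∑ s ∈ Finset.range (a / 2 + 1),
      ((qPoch p p a / (qPoch (p ^ 2) (p ^ 2) s * qPoch p p (a - 2 * s)) : ℝ) : ℂ) •
        hermiteI p (a - 2 * s) z = z ^ a := by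
  have hP0 : 0 < p ^ 2 := by positivity
  have hP1 : p ^ 2 < 1 := pow_lt_one₀ h0.le h1 two_ne_zero
  have hne := qPoch_self_ne_zero h0 h1
  have hNe := qPoch_self_ne_zero hP0 hP1
  -- The double sum is regrouped by `m = s + k`. The inner sum is then `sum_qPoch_inverse` with base
  -- `p²`, which leaves only `m = 0`.
  have hflip := Finset.sum_range_diag_flip (a / 2 + 1) fun s k =>
    ((qPoch p p a / qPoch p p (a - 2 * (s + k)) *
      ((-1) ^ k * (p ^ 2) ^ (k * (k - 1) / 2) /
        (qPoch (p ^ 2) (p ^ 2) k * qPoch (p ^ 2) (p ^ 2) s)) : ℝ) : ℂ) • z ^ (a - 2 * (s + k))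
  have hlhs : ∀ s ∈ Finset.range (a / 2 + 1),
      ((qPoch p p a / (qPoch (p ^ 2) (p ^ 2) s * qPoch p p (a - 2 * s)) : ℝ) : ℂ) •
        hermiteI p (a - 2 * s) z =
      ∑ k ∈ Finset.range (a / 2 + 1 - s), ((qPoch p p a / qPoch p p (a - 2 * (s + k)) *
      ((-1) ^ k * (p ^ 2) ^ (k * (k - 1) / 2) /
        (qPoch (p ^ 2) (p ^ 2) k * qPoch (p ^ 2) (p ^ 2) s)) : ℝ) : ℂ) • z ^ (a - 2 * (s + k)) := by
    intro s hs
    have hs' := Finset.mem_range.1 hs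
    rw [hermiteI, Finset.smul_sum, show (a - 2 * s) / 2 + 1 = a / 2 + 1 - s by omega]
    refine Finset.sum_congr rfl fun k _ => ?_
    rw [smul_smul, ← Complex.ofReal_mul, show a - 2 * s - 2 * k = a - 2 * (s + k) by omega]
    congr 2
    have hexp : (p ^ 2) ^ (k * (k - 1) / 2) = p ^ (k * (k - 1)) := by
      rw [← pow_mul, Nat.mul_div_cancel' (Nat.even_mul_pred_self k).two_dvd]
    rw [hexp]
    have := hne (a - 2 * s)
    have := hNe k
    have := hNe s
    have := hne (a - 2 * (s + k))
    field_simp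
  rw [Finset.sum_congr rfl hlhs, ← hflip]
  have hinner : ∀ m ∈ Finset.range (a / 2 + 1), ∑ k ∈ Finset.range (m + 1),
      ((qPoch p p a / qPoch p p (a - 2 * (k + (m - k))) *
      ((-1) ^ (m - k) * (p ^ 2) ^ ((m - k) * ((m - k) - 1) / 2) /
        (qPoch (p ^ 2) (p ^ 2) (m - k) * qPoch (p ^ 2) (p ^ 2) k)) : ℝ) : ℂ) •
          z ^ (a - 2 * (k + (m - k))) =
      if m = 0 then z ^ a else 0 := by
    intro m _
    have : ∀ k ∈ Finset.range (m + 1), ((qPoch p p a / qPoch p p (a - 2 * (k + (m - k))) *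
      ((-1) ^ (m - k) * (p ^ 2) ^ ((m - k) * ((m - k) - 1) / 2) /
        (qPoch (p ^ 2) (p ^ 2) (m - k) * qPoch (p ^ 2) (p ^ 2) k)) : ℝ) : ℂ) •
          z ^ (a - 2 * (k + (m - k))) =
        (((qPoch p p a / qPoch p p (a - 2 * m) *
      ((-1) ^ (m - k) * (p ^ 2) ^ ((m - k) * ((m - k) - 1) / 2) /
        (qPoch (p ^ 2) (p ^ 2) (m - k) * qPoch (p ^ 2) (p ^ 2) (m - (m - k)))) : ℝ) : ℂ)) •
          z ^ (a - 2 * m) := by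
      intro k hk
      have hk' := Finset.mem_range.1 hk
      rw [show k + (m - k) = m by omega, show m - (m - k) = k by omega]
    rw [Finset.sum_congr rfl this, ← Finset.sum_smul, ← Complex.ofReal_sum, ← Finset.mul_sum]
    have hrefl := Finset.sum_range_reflect (fun k => (-1) ^ k * (p ^ 2) ^ (k * (k - 1) / 2) /
        (qPoch (p ^ 2) (p ^ 2) k * qPoch (p ^ 2) (p ^ 2) (m - k))) (m + 1)
    simp only [Nat.add_sub_cancel] at hrefl
    rw [hrefl, sum_qPoch_inverse hP0 hP1]
    split_ifs with h
    · subst h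
      simp [hne a]
    · simp
  rw [Finset.sum_congr rfl hinner]
  simp

/-! ### The Gaussian and the Hermite Gaussian as separable series -/

/-- The power series `∑_k f_k (r X²)^k`. -/
def sqSeries (f : ℕ → ℂ) (r : ℂ) : PowerSeries ℂ :=
  PowerSeries.mk fun m => if Even m then f (m / 2) * r ^ (m / 2) else 0

theorem evalSeries_embed_sq {c : Fin n → Fin n → ℂ} (j : Fin n) (hj : c j j = 1) (f : ℕ → ℂ)
    (r : ℂ) : evalSeries f (embed c j hj (r • PowerSeries.X ^ 2)) =
      embed c j hj (sqSeries f r) := by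
  rw [evalSeries_embed]
  congr 1
  ext m
  simp only [sqSeries, PowerSeries.coeff_mk, smul_pow, ← pow_mul, PowerSeries.coeff_smul,
    PowerSeries.coeff_X_pow, smul_eq_mul]
  split_ifs with h
  · obtain ⟨k, rfl⟩ := h
    have hk : (k + k) / 2 = k := by omega
    rw [Finset.sum_eq_single k, if_pos (by ring), hk, mul_one]
    · intro b _ hb
      rw [if_neg (by omega), mul_zero, mul_zero]
    · intro h
      exact absurd (Finset.mem_range.2 (by omega)) h
  · refine Finset.sum_eq_zero fun k _ => ?_
    rw [if_neg, mul_zero, mul_zero]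
    rintro rfl
    exact h (even_two_mul k)

theorem embed_hermiteII {c : Fin n → Fin n → ℂ} (j : Fin n) (hj : c j j = 1) (p : ℝ) (l : ℕ) :
    embed c j hj (hermiteII p l PowerSeries.X) = hermiteII p l (gen c j) := by
  simp only [hermiteII, map_sum, embed_smul, map_pow, embed_X]

/-- The power series of `e_{q⁴}(-z²)`. -/
def gaussPS (q : ℝ) : PowerSeries ℂ := sqSeries (eCoeff (q ^ 4)) (-1)

theorem hermiteGaussian_eq_sep (a : Fin n → ℕ) :
    hermiteGaussian q a =
      sep _ fun j => gaussPS q * hermiteII (q ^ 2) (a j) PowerSeries.X := by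
  rw [← cov_prod_embed, hermiteGaussian]
  congr 2
  funext j
  rw [map_mul, embed_hermiteII, gaussPS, ← evalSeries_embed_sq, neg_one_smul, map_neg, map_pow,
    embed_X]
  rfl

theorem coeff_x_sq (j : Fin n) (F : Fin n →₀ ℕ) :
    (x q j ^ 2).coeff F = if F = Finsupp.single j 2 then 1 else 0 := by
  have h : x q j ^ 2 = embed (fun i j : Fin n => if j < i then (q : ℂ) else 1) j (cov_diag q j)
      (PowerSeries.X ^ 2) := by
    rw [map_pow, embed_X]
    rfl
  rw [h, coeff_embed]
  by_cases h : F = Finsupp.single j 2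
  · simp [h, PowerSeries.coeff_X_pow]
  · by_cases h' : F = Finsupp.single j (F j)
    · have : F j ≠ 2 := fun h2 => h (by rw [h', h2])
      simp [h, PowerSeries.coeff_X_pow, this]
    · simp [h, h']

/-- This is the `q⁴`-multinomial theorem, since `x_i² x_j² = q⁴ x_j² x_i²` for `i > j`. In the
induction one factor `x_j²` is split off on the left and moved past the smaller variables. -/
theorem coeff_neg_sum_sq_pow (hq0 : 0 < q) (hq1 : q < 1) (k : ℕ) (E : Fin n →₀ ℕ) :
    ((-∑ j, x q j ^ 2) ^ k).coeff E = if (∀ j, Even (E j)) ∧ E.degree = 2 * k then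
      (-1) ^ k * (qPoch (q ^ 4) (q ^ 4) k : ℂ) / ∏ j, (qPoch (q ^ 4) (q ^ 4) (E j / 2) : ℂ)
      else 0 := by
  have hP0 : 0 < q ^ 4 := by positivity
  have hP1 : q ^ 4 < 1 := pow_lt_one₀ hq0.le hq1 four_ne_zero
  have hne : ∀ k, (qPoch (q ^ 4) (q ^ 4) k : ℂ) ≠ 0 := fun k =>
    Complex.ofReal_ne_zero.2 (qPoch_self_ne_zero hP0 hP1 k)
  induction k generalizing E with
  | zero =>
    rw [pow_zero, coeff_one]
    by_cases h : E = 0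
    · subst h
      simp [qPoch]
    · have h0 : E.degree ≠ 0 := by rwa [Ne, Finsupp.degree_eq_zero_iff]
      simp [h, h0]
  | succ k ih =>
    rw [pow_succ', neg_mul, coeff_neg, Finset.sum_mul, coeff_sum]
    simp only [coeff_monomial_mul (coeff_x_sq _), ih]
    have hsub : ∀ j, Finsupp.single j 2 ≤ E → (E - Finsupp.single j 2) + Finsupp.single j 2 = E :=
      fun j hj => tsub_add_cancel_of_le hj
    have hdeg : ∀ j, Finsupp.single j 2 ≤ E → (E - Finsupp.single j 2).degree + 2 = E.degree := by
      intro j hj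
      conv_rhs => rw [← hsub j hj]
      simp
    have heven : ∀ j, Finsupp.single j 2 ≤ E →
        ((∀ i, Even ((E - Finsupp.single j 2 : Fin n →₀ ℕ) i)) ↔ ∀ i, Even (E i)) := by
      intro j hj
      refine forall_congr' fun i => ?_
      conv_rhs => rw [← hsub j hj, Finsupp.add_apply]
      by_cases hi : i = j
      · simp [hi, Nat.even_add]
      · simp [Finsupp.single_eq_of_ne hi]
    split_ifs with h
    · obtain ⟨hE, hd⟩ := h
      -- The formula also covers `E j = 0`, where the factor `1 - (q⁴)^0` vanishes. The redundant
      -- form `1 - (1 - ·)` prepares the telescoping identity below.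
      have hterm : ∀ j, (if Finsupp.single j 2 ≤ E then
          weight (fun i j : Fin n => if j < i then (q : ℂ) else 1) (Finsupp.single j 2)
            (E - Finsupp.single j 2) *
          (if (∀ i, Even ((E - Finsupp.single j 2 : Fin n →₀ ℕ) i)) ∧
              (E - Finsupp.single j 2).degree = 2 * k then
            (-1) ^ k * (qPoch (q ^ 4) (q ^ 4) k : ℂ) /
              ∏ i, (qPoch (q ^ 4) (q ^ 4) ((E - Finsupp.single j 2 : Fin n →₀ ℕ) i / 2) : ℂ) else 0) else 0) =
          ((-1) ^ k * (qPoch (q ^ 4) (q ^ 4) k : ℂ) /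
            ∏ i, (qPoch (q ^ 4) (q ^ 4) (E i / 2) : ℂ)) *
          ((1 - ((q : ℂ) ^ 4) ^ (E j / 2)) *
            ∏ i ∈ Finset.univ.filter (· < j), (1 - (1 - ((q : ℂ) ^ 4) ^ (E i / 2)))) := by
        intro j
        by_cases hj : Finsupp.single j 2 ≤ E
        · have h2 : 2 ≤ E j := by simpa using hj j
          rw [if_pos hj, if_pos ⟨(heven j hj).2 hE, by have := hdeg j hj; omega⟩]
          have hw : weight (fun i j : Fin n => if j < i then (q : ℂ) else 1) (Finsupp.single j 2)
              (E - Finsupp.single j 2) =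
              ∏ i ∈ Finset.univ.filter (· < j), (1 - (1 - ((q : ℂ) ^ 4) ^ (E i / 2))) := by
            rw [weight_cov, Finset.prod_eq_single j, Finsupp.single_eq_same,
              ← Finset.prod_pow_eq_pow_sum, ← Finset.prod_pow]
            · refine Finset.prod_congr rfl fun i hi => ?_
              have hij : i ≠ j := (Finset.mem_filter.1 hi).2.ne
              obtain ⟨m, hm⟩ := (hE i).two_dvd
              rw [Finsupp.tsub_apply, Finsupp.single_eq_of_ne hij, tsub_zero, hm,
                Nat.mul_div_cancel_left _ two_pos, sub_sub_cancel, ← pow_mul, ← pow_mul]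
              congr 1
              ring
            · intro i _ hij
              simp [Finsupp.single_eq_of_ne hij]
            · simp
          have hprod : ∏ i, (qPoch (q ^ 4) (q ^ 4) (E i / 2) : ℂ) =
              (∏ i, (qPoch (q ^ 4) (q ^ 4) ((E - Finsupp.single j 2 : Fin n →₀ ℕ) i / 2) : ℂ)) *
                (1 - ((q : ℂ) ^ 4) ^ (E j / 2)) := by
            rw [← Finset.mul_prod_erase _ _ (Finset.mem_univ j),
              ← Finset.mul_prod_erase _ (fun i => (qPoch (q ^ 4) (q ^ 4)
                ((E - Finsupp.single j 2 : Fin n →₀ ℕ) i / 2) : ℂ)) (Finset.mem_univ j)]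
            have e1 : (E - Finsupp.single j 2 : Fin n →₀ ℕ) j / 2 + 1 = E j / 2 := by
              rw [Finsupp.tsub_apply, Finsupp.single_eq_same]
              omega
            have e2 : ∏ i ∈ Finset.univ.erase j, (qPoch (q ^ 4) (q ^ 4) (E i / 2) : ℂ) =
                ∏ i ∈ Finset.univ.erase j,
                  (qPoch (q ^ 4) (q ^ 4) ((E - Finsupp.single j 2 : Fin n →₀ ℕ) i / 2) : ℂ) := by
              refine Finset.prod_congr rfl fun i hi => ?_
              rw [Finsupp.tsub_apply, Finsupp.single_eq_of_ne (Finset.ne_of_mem_erase hi),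
                tsub_zero]
            rw [e2, ← e1, qPoch_self_succ]
            push_cast
            ring
          have hn1 : (1 - ((q : ℂ) ^ 4) ^ (E j / 2)) ≠ 0 := by
            intro h0
            have h3 : ∏ i, (qPoch (q ^ 4) (q ^ 4) (E i / 2) : ℂ) = 0 := by
              rw [hprod, h0, mul_zero]
            exact Finset.prod_ne_zero_iff.2 (fun i _ => hne _) h3
          have hn2 : ∏ i, (qPoch (q ^ 4) (q ^ 4) ((E - Finsupp.single j 2 : Fin n →₀ ℕ) i / 2) : ℂ) ≠ 0 :=
            Finset.prod_ne_zero_iff.2 fun i _ => hne _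
          rw [hw, hprod]
          field_simp
        · have h0 : E j = 0 := by
            by_contra h0
            apply hj
            rw [Finsupp.single_le_iff]
            obtain ⟨m, hm⟩ := hE j
            omega
          simp [hj, h0]
      rw [Finset.sum_congr rfl fun j _ => hterm j, ← Finset.mul_sum]
      -- With `Q = q⁴` and `m_j = e_j / 2`, the sum of `(1 - Q^{m_j}) ∏_{i<j} Q^{m_i}` telescopes to
      -- `1 - Q^{k+1}`, the new factor of `(Q; Q)_{k+1}`.
      have htel := Finset.prod_one_sub_ordered (Finset.univ : Finset (Fin n))
        (fun j => 1 - ((q : ℂ) ^ 4) ^ (E j / 2))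
      have hsum : ∏ j, (1 - (1 - ((q : ℂ) ^ 4) ^ (E j / 2))) = ((q : ℂ) ^ 4) ^ (k + 1) := by
        simp only [sub_sub_cancel]
        rw [Finset.prod_pow_eq_pow_sum]
        congr 1
        have : ∑ j, 2 * (E j / 2) = 2 * (k + 1) := by
          rw [← hd, Finsupp.degree_eq_sum]
          exact Finset.sum_congr rfl fun j _ => Nat.mul_div_cancel' (hE j).two_dvd
        rw [← Finset.mul_sum] at this
        omega
      rw [hsum] at htel
      rw [show ∑ j, (1 - ((q : ℂ) ^ 4) ^ (E j / 2)) *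
          ∏ i ∈ Finset.univ.filter (· < j), (1 - (1 - ((q : ℂ) ^ 4) ^ (E i / 2))) =
          1 - ((q : ℂ) ^ 4) ^ (k + 1) by rw [htel]; ring]
      rw [qPoch_self_succ]
      push_cast
      ring
    · rw [neg_eq_zero]
      refine Finset.sum_eq_zero fun j _ => ?_
      split_ifs with hj h'
      · exact absurd ⟨(heven j hj).1 h'.1, by have := hdeg j hj; omega⟩ h
      · simp
      · rfl

/-- The numerator `(q⁴;q⁴)_k` of the multinomial coefficient cancels the denominator in the series
of `e_{q⁴}`. -/
theorem gaussian_eq_sep (hq0 : 0 < q) (hq1 : q < 1) :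
    gaussian q n = sep _ fun _ => gaussPS q := by
  have hP0 : 0 < q ^ 4 := by positivity
  have hP1 : q ^ 4 < 1 := pow_lt_one₀ hq0.le hq1 four_ne_zero
  have hne : ∀ k, (qPoch (q ^ 4) (q ^ 4) k : ℂ) ≠ 0 := fun k =>
    Complex.ofReal_ne_zero.2 (qPoch_self_ne_zero hP0 hP1 k)
  ext E
  simp only [gaussian, evalSeries, coeff_neg_sum_sq_pow hq0 hq1, coeff_sep, gaussPS, sqSeries,
    PowerSeries.coeff_mk]
  rw [Finset.prod_ite_zero]
  by_cases hE : ∀ j, Even (E j)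
  · have hd : ∑ j, E j / 2 * 2 = E.degree := by
      rw [Finsupp.degree_eq_sum]
      exact Finset.sum_congr rfl fun j _ => Nat.div_mul_cancel (hE j).two_dvd
    rw [← Finset.sum_mul] at hd
    rw [if_pos (fun j _ => hE j), Finset.sum_eq_single (∑ j, E j / 2)]
    · rw [if_pos ⟨hE, by omega⟩, Finset.prod_mul_distrib, Finset.prod_pow_eq_pow_sum]
      simp only [eCoeff]
      push_cast
      rw [Finset.prod_div_distrib, Finset.prod_const_one]
      have := hne (∑ j, E j / 2)
      field_simp
    · intro k _ hk
      rw [if_neg (fun h => hk (by omega)), mul_zero]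
    · intro h
      exact absurd (Finset.mem_range.2 (by omega)) h
  · rw [if_neg (by simpa using hE)]
    refine Finset.sum_eq_zero fun k _ => ?_
    rw [if_neg (fun h => hE h.1), mul_zero]

/-! ### The recurrence of the discrete Hermite II polynomials -/

/-- The coefficient of `z^{l-2k}` in `h̃_l(z; p)`. -/
def hermiteIICoeff (p : ℝ) (l k : ℕ) : ℝ :=
  if 2 * k ≤ l then qPoch p p l * ((-1) ^ k * p ^ (-2 * (k : ℤ) * l + k * (2 * k + 1)) /
      (qPoch (p ^ 2) (p ^ 2) k * qPoch p p (l - 2 * k))) else 0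

theorem hermiteII_eq_sum (p : ℝ) (l N : ℕ) (hN : l / 2 < N) (z : ℂ) :
    hermiteII p l z = ∑ k ∈ Finset.range N, (hermiteIICoeff p l k : ℂ) * z ^ (l - 2 * k) := by
  rw [hermiteII, ← Finset.sum_subset (Finset.range_subset_range.2 hN)]
  · refine Finset.sum_congr rfl fun k hk => ?_
    have := Finset.mem_range.1 hk
    rw [hermiteIICoeff, if_pos (by omega), smul_eq_mul]
  · intro k _ hk
    have : ¬ k < l / 2 + 1 := fun h => hk (Finset.mem_range.2 h)
    rw [hermiteIICoeff, if_neg (by omega)]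
    simp

theorem hermiteIICoeff_zero {p : ℝ} (h0 : 0 < p) (h1 : p < 1) (l : ℕ) :
    hermiteIICoeff p l 0 = 1 := by
  have := qPoch_self_ne_zero h0 h1 l
  simp [hermiteIICoeff, qPoch] at this ⊢
  field_simp

/-- The recurrence `hermiteII_succ` compared coefficient by coefficient. -/
theorem hermiteIICoeff_succ {p : ℝ} (h0 : 0 < p) (h1 : p < 1) (a k : ℕ) :
    p ^ (a - 2 * (k + 1)) * hermiteIICoeff p a (k + 1) +
      (p ^ (a - 2 * k) - 1) * hermiteIICoeff p a k = p ^ a * hermiteIICoeff p (a + 1) (k + 1) := by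
  have hP0 : 0 < p ^ 2 := by positivity
  have hP1 : p ^ 2 < 1 := pow_lt_one₀ h0.le h1 two_ne_zero
  have hne := qPoch_self_ne_zero h0 h1
  have hNe := qPoch_self_ne_zero hP0 hP1
  have hpow : ∀ m : ℕ, (1 : ℝ) - p ^ (m + 1) ≠ 0 := fun m =>
    (sub_pos.2 (pow_lt_one₀ h0.le h1 (Nat.succ_ne_zero m))).ne'
  rcases lt_or_ge a (2 * k + 1) with h | h
  · rw [hermiteIICoeff, hermiteIICoeff, hermiteIICoeff, if_neg (by omega : ¬ 2 * (k + 1) ≤ a),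
      if_neg (by omega : ¬ 2 * (k + 1) ≤ a + 1)]
    rcases lt_or_ge a (2 * k) with h' | h'
    · rw [if_neg (by omega)]
      simp
    · rw [show a - 2 * k = 0 by omega]
      simp
  · obtain ⟨m, rfl⟩ := Nat.exists_eq_add_of_le h
    have hQ : qPoch (p ^ 2) (p ^ 2) (k + 1) = qPoch (p ^ 2) (p ^ 2) k * (1 - p ^ (2 * k + 1 + 1)) := by
      rw [qPoch_self_succ, ← pow_mul]
      congr 3
    have hz : p ≠ 0 := h0.ne'
    set e : ℤ := -2 * (k : ℤ) * ((2 * k + 1 + m : ℕ) : ℤ) + k * (2 * k + 1) with he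
    have hc0 : hermiteIICoeff p (2 * k + 1 + m) k = qPoch p p (2 * k + 1 + m) *
        ((-1) ^ k * p ^ e / (qPoch (p ^ 2) (p ^ 2) k * (qPoch p p m * (1 - p ^ (m + 1))))) := by
      rw [hermiteIICoeff, if_pos (by omega), show 2 * k + 1 + m - 2 * k = m + 1 by omega,
        qPoch_self_succ p m]
    have hc2 : p ^ (2 * k + 1 + m) * hermiteIICoeff p (2 * k + 1 + m + 1) (k + 1) =
        qPoch p p (2 * k + 1 + m) * (1 - p ^ (2 * k + 1 + m + 1)) *
        ((-1) ^ (k + 1) * (p ^ e / p ^ m) /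
          (qPoch (p ^ 2) (p ^ 2) k * (1 - p ^ (2 * k + 1 + 1)) * qPoch p p m)) := by
      rw [hermiteIICoeff, if_pos (by omega),
        show 2 * k + 1 + m + 1 - 2 * (k + 1) = m by omega, qPoch_self_succ p (2 * k + 1 + m), hQ]
      have : p ^ (2 * k + 1 + m) * p ^ (-2 * ((k + 1 : ℕ) : ℤ) * ((2 * k + 1 + m + 1 : ℕ) : ℤ) +
          ((k + 1 : ℕ) : ℤ) * (2 * ((k + 1 : ℕ) : ℤ) + 1)) = p ^ e / p ^ m := by
        rw [← zpow_natCast, ← zpow_natCast, ← zpow_add₀ hz, ← zpow_sub₀ hz]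
        congr 1
        rw [he]
        push_cast
        ring
      rw [← this]
      ring
    have hc1 : p ^ (2 * k + 1 + m - 2 * (k + 1)) * hermiteIICoeff p (2 * k + 1 + m) (k + 1) =
        qPoch p p (2 * k + 1 + m) *
        ((-1) ^ (k + 1) * (p ^ e / p ^ m) * (1 - p ^ m) /
          (qPoch (p ^ 2) (p ^ 2) k * (1 - p ^ (2 * k + 1 + 1)) * qPoch p p m)) := by
      -- For `m = 0` the coefficient is cut off to `0`, in agreement with the factor `1 - p^m` of
      -- the closed form.
      cases m with
      | zero =>
        rw [hermiteIICoeff, if_neg (by omega)]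
        simp
      | succ m =>
        rw [hermiteIICoeff, if_pos (by omega),
          show 2 * k + 1 + (m + 1) - 2 * (k + 1) = m by omega, qPoch_self_succ p m, hQ]
        have : p ^ m * p ^ (-2 * ((k + 1 : ℕ) : ℤ) * ((2 * k + 1 + (m + 1) : ℕ) : ℤ) +
            ((k + 1 : ℕ) : ℤ) * (2 * ((k + 1 : ℕ) : ℤ) + 1)) = p ^ e / p ^ (m + 1) := by
          rw [← zpow_natCast, ← zpow_natCast, ← zpow_add₀ hz, ← zpow_sub₀ hz]
          congr 1
          rw [he]
          push_cast
          ring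
        rw [← this]
        have := hpow m
        have := hne m
        have := hNe k
        have := hpow (2 * k + 1)
        field_simp
    rw [hc1, hc2, hc0, show 2 * k + 1 + m - 2 * k = m + 1 by omega]
    have := hpow m
    have := hne m
    have := hNe k
    have := hpow (2 * k + 1)
    have : p ^ m ≠ 0 := pow_ne_zero _ hz
    have : p ^ e ≠ 0 := zpow_ne_zero _ hz
    field_simp
    ring

/-- The raising relation: with the functional equation of the Gaussian, the left side times `g` is
the `p`-difference of `g h̃_a`. -/
theorem hermiteII_succ {p : ℝ} (h0 : 0 < p) (h1 : p < 1) (a : ℕ) (z : ℂ) :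
    (1 + z ^ 2) * hermiteII p a (p * z) - hermiteII p a z =
      p ^ a * z * hermiteII p (a + 1) z := by
  -- The ranges are longer than needed so that the three sums can be aligned after a shift; the
  -- surplus coefficients are `0`.
  set N := a / 2 + 2 with hN
  rw [hermiteII_eq_sum p a (N + 1) (by omega), hermiteII_eq_sum p a N (by omega),
    hermiteII_eq_sum p (a + 1) (N + 1) (by omega)]
  have e1 : (1 + z ^ 2) * ∑ k ∈ Finset.range (N + 1),
      (hermiteIICoeff p a k : ℂ) * (p * z) ^ (a - 2 * k) =
      ∑ k ∈ Finset.range N, (hermiteIICoeff p a k : ℂ) * (p * z) ^ (a - 2 * k) +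
      (∑ k ∈ Finset.range N,
        z ^ 2 * ((hermiteIICoeff p a (k + 1) : ℂ) * (p * z) ^ (a - 2 * (k + 1))) +
        z ^ 2 * ((hermiteIICoeff p a 0 : ℂ) * (p * z) ^ (a - 2 * 0))) := by
    rw [add_mul, one_mul, Finset.mul_sum]
    congr 1
    · rw [Finset.sum_range_succ, hermiteIICoeff, if_neg (by omega)]
      simp
    · rw [Finset.sum_range_succ']
  rw [e1, Finset.sum_range_succ' (fun k => (hermiteIICoeff p (a + 1) k : ℂ) * _) N,
    hermiteIICoeff_zero h0 h1,
    hermiteIICoeff_zero h0 h1]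
  have e2 : ∀ k ∈ Finset.range N, (hermiteIICoeff p a k : ℂ) * (p * z) ^ (a - 2 * k) +
      z ^ 2 * ((hermiteIICoeff p a (k + 1) : ℂ) * (p * z) ^ (a - 2 * (k + 1))) -
      (hermiteIICoeff p a k : ℂ) * z ^ (a - 2 * k) =
      p ^ a * z * ((hermiteIICoeff p (a + 1) (k + 1) : ℂ) * z ^ (a + 1 - 2 * (k + 1))) := by
    intro k _
    have h := congrArg (fun r : ℝ => (r : ℂ)) (hermiteIICoeff_succ h0 h1 a k)
    push_cast at h
    rw [mul_pow, mul_pow]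
    rcases lt_trichotomy a (2 * k + 1) with hlt | heq | hgt
    · rw [hermiteIICoeff, hermiteIICoeff, hermiteIICoeff, if_neg (by omega : ¬ 2 * (k + 1) ≤ a),
        if_neg (by omega : ¬ 2 * (k + 1) ≤ a + 1)]
      rcases lt_or_ge a (2 * k) with h' | h'
      · rw [if_neg (by omega)]
        simp
      · rw [show a - 2 * k = 0 by omega]
        simp
    · have hz0 : hermiteIICoeff p a (k + 1) = 0 := by rw [hermiteIICoeff, if_neg (by omega)]
      rw [hz0, Complex.ofReal_zero] at h ⊢
      rw [show a + 1 - 2 * (k + 1) = 0 by omega]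
      rw [show a - 2 * k = 1 by omega] at h ⊢
      linear_combination z * h
    · obtain ⟨m, hm⟩ := Nat.exists_eq_add_of_le (show 2 * k + 2 ≤ a by omega)
      rw [show a + 1 - 2 * (k + 1) = m + 1 by omega]
      rw [show a - 2 * k = m + 2 by omega, show a - 2 * (k + 1) = m by omega] at h ⊢
      linear_combination z ^ (m + 2) * h
  rw [mul_add, Finset.mul_sum, ← Finset.sum_congr rfl e2, Finset.sum_sub_distrib,
    Finset.sum_add_distrib, mul_pow]
  push_cast
  simp only [tsub_zero]
  ring

theorem hermiteII_zero (p : ℝ) (z : ℂ) : hermiteII p 0 z = 1 := by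
  simp [hermiteII, qPoch]

theorem hermiteII_one {p : ℝ} (h0 : 0 < p) (h1 : p < 1) (z : ℂ) : hermiteII p 1 z = z := by
  have : qPoch p p 1 ≠ 0 := qPoch_self_ne_zero h0 h1 1
  simp [hermiteII, qPoch] at this ⊢
  have h : (1 - (p : ℂ)) ≠ 0 := by exact_mod_cast this
  field_simp

/-! ### One-variable realizations -/

/-- `F` is the sum of the power series `φ` near `0` and is analytic in a strip around `ℝ`. -/
def Realizes (φ : PowerSeries ℂ) (F : ℂ → ℂ) : Prop :=
  (∀ᶠ z in 𝓝 (0 : ℂ), HasSum (fun m => PowerSeries.coeff m φ * z ^ m) (F z)) ∧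
  ∃ r > 0, AnalyticOnNhd ℂ F {z | |z.im| < r}

theorem hasFPowerSeriesAt_iff_coeff (φ : PowerSeries ℂ) (F : ℂ → ℂ) :
    HasFPowerSeriesAt F
      (FormalMultilinearSeries.ofScalars ℂ fun m => PowerSeries.coeff m φ) 0 ↔
    ∀ᶠ z in 𝓝 (0 : ℂ), HasSum (fun m => PowerSeries.coeff m φ * z ^ m) (F z) := by
  rw [hasFPowerSeriesAt_iff]
  simp only [FormalMultilinearSeries.coeff_ofScalars, smul_eq_mul, zero_add, mul_comm]

theorem powerSeries_unique {φ ψ : PowerSeries ℂ} {F : ℂ → ℂ}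
    (hφ : ∀ᶠ z in 𝓝 (0 : ℂ), HasSum (fun m => PowerSeries.coeff m φ * z ^ m) (F z))
    (hψ : ∀ᶠ z in 𝓝 (0 : ℂ), HasSum (fun m => PowerSeries.coeff m ψ * z ^ m) (F z)) : φ = ψ := by
  have h := ((hasFPowerSeriesAt_iff_coeff φ F).2 hφ).eq_formalMultilinearSeries
    ((hasFPowerSeriesAt_iff_coeff ψ F).2 hψ)
  ext m
  have := congrArg (fun p => FormalMultilinearSeries.coeff p m) h
  simpa only [FormalMultilinearSeries.coeff_ofScalars] using this

theorem hasSum_coeff_mul {φ ψ : PowerSeries ℂ} {z s t : ℂ}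
    (hφ : HasSum (fun m => PowerSeries.coeff m φ * z ^ m) s)
    (hψ : HasSum (fun m => PowerSeries.coeff m ψ * z ^ m) t) :
    HasSum (fun m => PowerSeries.coeff m (φ * ψ) * z ^ m) (s * t) := by
  have heq : (fun m => PowerSeries.coeff m (φ * ψ) * z ^ m) = fun m =>
      ∑ p ∈ Finset.HasAntidiagonal.antidiagonal m, (PowerSeries.coeff p.1 φ * z ^ p.1) *
        (PowerSeries.coeff p.2 ψ * z ^ p.2) := by
    funext m
    rw [PowerSeries.coeff_mul, Finset.sum_mul]
    refine Finset.sum_congr rfl fun p hp => ?_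
    rw [← Finset.HasAntidiagonal.mem_antidiagonal.1 hp, pow_add]
    ring
  rw [heq, ← hφ.tsum_eq, ← hψ.tsum_eq,
    tsum_mul_tsum_eq_tsum_sum_antidiagonal_of_summable_norm hφ.summable.norm hψ.summable.norm]
  exact (summable_norm_sum_mul_antidiagonal_of_summable_norm hφ.summable.norm
    hψ.summable.norm).of_norm.hasSum

theorem hasSum_coeff_rescale {φ : PowerSeries ℂ} {F : ℂ → ℂ}
    (h : ∀ᶠ z in 𝓝 (0 : ℂ), HasSum (fun m => PowerSeries.coeff m φ * z ^ m) (F z)) (c : ℂ) :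
    ∀ᶠ z in 𝓝 (0 : ℂ),
      HasSum (fun m => PowerSeries.coeff m (PowerSeries.rescale c φ) * z ^ m) (F (c * z)) := by
  have ht : Tendsto (fun z : ℂ => c * z) (𝓝 0) (𝓝 0) := by
    have : Continuous fun z : ℂ => c * z := by fun_prop
    simpa using this.tendsto 0
  filter_upwards [ht.eventually h] with z hz
  simpa only [PowerSeries.coeff_rescale, mul_pow, mul_comm, mul_left_comm, mul_assoc] using hz

namespace Realizes

variable {φ ψ : PowerSeries ℂ} {F G : ℂ → ℂ}

theorem mul (h : Realizes φ F) (h' : Realizes ψ G) : Realizes (φ * ψ) fun z => F z * G z := by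
  obtain ⟨h1, r, hr, h2⟩ := h
  obtain ⟨h1', r', hr', h2'⟩ := h'
  refine ⟨?_, min r r', lt_min hr hr', fun z hz => ?_⟩
  · filter_upwards [h1, h1'] with z hz hz' using hasSum_coeff_mul hz hz'
  · exact (h2 z (show |z.im| < r from lt_of_lt_of_le hz (min_le_left _ _))).mul
      (h2' z (show |z.im| < r' from lt_of_lt_of_le hz (min_le_right _ _)))

theorem add (h : Realizes φ F) (h' : Realizes ψ G) : Realizes (φ + ψ) fun z => F z + G z := by
  obtain ⟨h1, r, hr, h2⟩ := h
  obtain ⟨h1', r', hr', h2'⟩ := h'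
  refine ⟨?_, min r r', lt_min hr hr', fun z hz => ?_⟩
  · filter_upwards [h1, h1'] with z hz hz'
    simpa only [map_add, add_mul] using hz.add hz'
  · exact (h2 z (show |z.im| < r from lt_of_lt_of_le hz (min_le_left _ _))).add
      (h2' z (show |z.im| < r' from lt_of_lt_of_le hz (min_le_right _ _)))

theorem smul (h : Realizes φ F) (c : ℂ) : Realizes (c • φ) fun z => c * F z := by
  obtain ⟨h1, r, hr, h2⟩ := h
  refine ⟨?_, r, hr, fun z hz => analyticAt_const.mul (h2 z hz)⟩
  filter_upwards [h1] with z hz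
  simpa only [PowerSeries.coeff_smul, smul_eq_mul, mul_assoc] using hz.mul_left c

theorem rescale (h : Realizes φ F) (c : ℝ) :
    Realizes (PowerSeries.rescale (c : ℂ) φ) fun z => F (c * z) := by
  obtain ⟨h1, r, hr, h2⟩ := h
  refine ⟨hasSum_coeff_rescale h1 c, r / (|c| + 1), by positivity, fun z hz => ?_⟩
  have hz' : |z.im| < r / (|c| + 1) := hz
  have hmem : |((c : ℂ) * z).im| < r := by
    rw [Complex.im_ofReal_mul, abs_mul]
    rw [lt_div_iff₀ (by positivity)] at hz'
    nlinarith [abs_nonneg z.im]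
  exact (h2 _ hmem).comp_of_eq (analyticAt_const.mul analyticAt_id) rfl

theorem even (h : Realizes φ F) :
    Realizes (evenPS φ) fun z => 2⁻¹ * (F z + F (-z)) := by
  have := (h.add (h.rescale (-1))).smul 2⁻¹
  simpa [evenPS] using this

theorem zero : Realizes 0 fun _ => 0 :=
  ⟨Eventually.of_forall fun z => by simp, 1, one_pos,
    fun _ _ => analyticAt_const⟩

theorem pow_X (m : ℕ) : Realizes (PowerSeries.X ^ m) fun z => z ^ m := by
  refine ⟨Eventually.of_forall fun z => ?_, 1, one_pos, fun z _ => analyticAt_id.pow m⟩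
  have : (fun k => PowerSeries.coeff k (PowerSeries.X ^ m : PowerSeries ℂ) * z ^ k) =
      fun k => if k = m then z ^ m else 0 := by
    funext k
    rw [PowerSeries.coeff_X_pow]
    split_ifs with h
    · rw [h, one_mul]
    · rw [zero_mul]
  rw [this]
  exact hasSum_ite_eq m (z ^ m)

theorem sum {ι : Type*} (s : Finset ι) {φ : ι → PowerSeries ℂ} {F : ι → ℂ → ℂ}
    (h : ∀ i ∈ s, Realizes (φ i) (F i)) : Realizes (∑ i ∈ s, φ i) fun z => ∑ i ∈ s, F i z := by
  classical
  induction s using Finset.induction_on with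
  | empty => simpa using zero
  | insert a s ha ih =>
    simp only [Finset.sum_insert ha]
    exact (h a (Finset.mem_insert_self a s)).add
      (ih fun i hi => h i (Finset.mem_insert_of_mem hi))

theorem hermiteII (p : ℝ) (l : ℕ) :
    Realizes (BraidedFourier.hermiteII p l PowerSeries.X) (BraidedFourier.hermiteII p l) :=
  Realizes.sum _ fun k _ => (pow_X (l - 2 * k)).smul _

end Realizes

/-! ### The Gaussian -/

/-- The entire function `(-z²; q⁴)_∞`. -/
def gaussDenom (q : ℝ) (z : ℂ) : ℂ := ∏' l : ℕ, (1 + ((q : ℂ) ^ 4) ^ l * z ^ 2)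

/-- The analytic continuation of `e_{q⁴}(-z²)`. -/
def gaussFun (q : ℝ) (z : ℂ) : ℂ := (gaussDenom q z)⁻¹

theorem norm_q_pow_four_lt (hq0 : 0 < q) (hq1 : q < 1) : ‖(q : ℂ) ^ 4‖ < 1 := by
  rw [norm_pow, Complex.norm_real, Real.norm_of_nonneg hq0.le]
  exact pow_lt_one₀ hq0.le hq1 four_ne_zero

theorem summable_gaussDenom (hq0 : 0 < q) (hq1 : q < 1) (z : ℂ) :
    Summable fun l : ℕ => ‖((q : ℂ) ^ 4) ^ l * z ^ 2‖ :=
  ((summable_geometric_of_norm_lt_one (norm_q_pow_four_lt hq0 hq1)).mul_right (z ^ 2)).norm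

theorem gaussDenom_eq (hq0 : 0 < q) (hq1 : q < 1) (z : ℂ) :
    gaussDenom q z = (1 + z ^ 2) * gaussDenom q ((q : ℂ) ^ 2 * z) := by
  have h : ∀ l : ℕ, ((q : ℂ) ^ 4) ^ (l + 1) * z ^ 2 = ((q : ℂ) ^ 4) ^ l * ((q : ℂ) ^ 2 * z) ^ 2 :=
    fun l => by ring
  rw [gaussDenom, tprod_eq_zero_mul', gaussDenom]
  · simp only [h, pow_zero, one_mul]
  · simp only [h]
    exact multipliable_one_add_of_summable (summable_gaussDenom hq0 hq1 _)

/-- A vanishing factor `1 + q^{4l} z²` forces `z = ±i q^{-2l}`, whose imaginary part has absolute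
value at least `1`. -/
theorem gaussDenom_ne_zero (hq0 : 0 < q) (hq1 : q < 1) {z : ℂ} (hz : |z.im| < 1) :
    gaussDenom q z ≠ 0 := by
  refine tprod_one_add_ne_zero_of_summable (fun l h => ?_) (summable_gaussDenom hq0 hq1 z)
  set w : ℂ := ((q ^ (2 * l) : ℝ) : ℂ) * z with hw
  have hw2 : w ^ 2 = Complex.I ^ 2 := by
    rw [Complex.I_sq, hw]
    push_cast
    linear_combination h
  have him : |w.im| = 1 := by
    rcases sq_eq_sq_iff_eq_or_eq_neg.1 hw2 with h | h <;> simp [h]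
  rw [hw, Complex.im_ofReal_mul, abs_mul, abs_of_pos (by positivity)] at him
  have h1 : q ^ (2 * l) ≤ 1 := pow_le_one₀ hq0.le hq1.le
  nlinarith [abs_nonneg z.im]

theorem differentiable_gaussDenom (hq0 : 0 < q) (hq1 : q < 1) :
    Differentiable ℂ (gaussDenom q) := by
  intro z
  have hR : DifferentiableOn ℂ (gaussDenom q) (Metric.ball 0 (‖z‖ + 1)) := by
    have hprod : HasProdLocallyUniformlyOn (fun (l : ℕ) (z : ℂ) => 1 + ((q : ℂ) ^ 4) ^ l * z ^ 2)
        (gaussDenom q) (Metric.ball 0 (‖z‖ + 1)) := by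
      refine Summable.hasProdLocallyUniformlyOn_nat_one_add
        (u := fun l => ‖(q : ℂ) ^ 4‖ ^ l * (‖z‖ + 1) ^ 2) Metric.isOpen_ball
        ((summable_geometric_of_lt_one (norm_nonneg _) (norm_q_pow_four_lt hq0 hq1)).mul_right _)
        (Eventually.of_forall fun l w hw => ?_) (fun l => by fun_prop)
      simp only [norm_mul, norm_pow]
      have : ‖w‖ ≤ ‖z‖ + 1 := (mem_ball_zero_iff.1 hw).le
      gcongr
    refine hprod.differentiableOn (Eventually.of_forall fun s => ?_) Metric.isOpen_ball
    simpa [Finset.prod_fn] using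
      DifferentiableOn.finsetProd (fun (l : ℕ) _ => by fun_prop)
  exact hR.differentiableAt (Metric.isOpen_ball.mem_nhds (by simp))

theorem analyticOnNhd_gaussFun (hq0 : 0 < q) (hq1 : q < 1) :
    AnalyticOnNhd ℂ (gaussFun q) {z | |z.im| < 1} := fun z hz =>
  ((differentiable_gaussDenom hq0 hq1).analyticAt z).inv (gaussDenom_ne_zero hq0 hq1 hz)

theorem gaussFun_mul (hq0 : 0 < q) (hq1 : q < 1) {z : ℂ} (hz : |z.im| < 1) :
    gaussFun q ((q : ℂ) ^ 2 * z) = (1 + z ^ 2) * gaussFun q z := by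
  have h := gaussDenom_ne_zero hq0 hq1 hz
  rw [gaussDenom_eq hq0 hq1] at h
  have h1 := left_ne_zero_of_mul h
  have h2 := right_ne_zero_of_mul h
  rw [gaussFun, gaussFun, gaussDenom_eq hq0 hq1 z]
  field_simp

theorem gaussFun_zero : gaussFun q 0 = 1 := by
  simp [gaussFun, gaussDenom]

/-- The functional equation reads `(q^{2m} - 1) φ_m = φ_{m-2}`. Since `q^{2m} ≠ 1` for `m > 0`, the
constant term determines everything, and the odd coefficients vanish. -/
theorem gaussPS_unique (hq0 : 0 < q) (hq1 : q < 1) {φ : PowerSeries ℂ}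
    (h0 : PowerSeries.coeff 0 φ = 1)
    (h : PowerSeries.rescale ((q : ℂ) ^ 2) φ = φ + φ * PowerSeries.X ^ 2) : φ = gaussPS q := by
  have hP0 : 0 < q ^ 4 := by positivity
  have hP1 : q ^ 4 < 1 := pow_lt_one₀ hq0.le hq1 four_ne_zero
  have hrec : ∀ m, (((q : ℂ) ^ 2) ^ m - 1) * PowerSeries.coeff m φ =
      if 2 ≤ m then PowerSeries.coeff (m - 2) φ else 0 := by
    intro m
    have := congrArg (PowerSeries.coeff m) h
    rw [PowerSeries.coeff_rescale, map_add, PowerSeries.coeff_mul_X_pow'] at this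
    linear_combination this
  have hne : ∀ m, ((q : ℂ) ^ 2) ^ (m + 1) - 1 ≠ 0 := by
    intro m h
    have h2 : (q ^ 2) ^ (m + 1) = 1 := by exact_mod_cast sub_eq_zero.1 h
    exact absurd h2 (pow_lt_one₀ (by positivity) (pow_lt_one₀ hq0.le hq1 two_ne_zero)
      (Nat.succ_ne_zero m)).ne
  have heven : ∀ k, PowerSeries.coeff (2 * k) φ = eCoeff (q ^ 4) k * (-1) ^ k ∧
      PowerSeries.coeff (2 * k + 1) φ = 0 := by
    intro k
    induction k with
    | zero =>
      refine ⟨by simp [h0, eCoeff, qPoch], ?_⟩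
      have := hrec 1
      rw [if_neg (by omega)] at this
      exact (mul_eq_zero.1 this).resolve_left (hne 0)
    | succ k ih =>
      constructor
      · have := hrec (2 * k + 1 + 1)
        rw [if_pos (by omega), show 2 * k + 1 + 1 - 2 = 2 * k by omega, ih.1] at this
        have hn := hne (2 * k + 1)
        rw [show 2 * (k + 1) = 2 * k + 1 + 1 by omega]
        refine mul_left_cancel₀ hn (this.trans ?_)
        have h1 : (qPoch (q ^ 4) (q ^ 4) k : ℂ) ≠ 0 :=
          Complex.ofReal_ne_zero.2 (qPoch_self_ne_zero hP0 hP1 k)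
        have h2 : (qPoch (q ^ 4) (q ^ 4) (k + 1) : ℂ) ≠ 0 :=
          Complex.ofReal_ne_zero.2 (qPoch_self_ne_zero hP0 hP1 (k + 1))
        simp only [eCoeff]
        push_cast
        field_simp
        rw [qPoch_self_succ]
        push_cast
        ring
      · have := hrec (2 * k + 2 + 1)
        rw [if_pos (by omega), show 2 * k + 2 + 1 - 2 = 2 * k + 1 by omega, ih.2] at this
        exact (mul_eq_zero.1 this).resolve_left (hne _)
  ext m
  rw [gaussPS, sqSeries, PowerSeries.coeff_mk]
  split_ifs with hm
  · obtain ⟨k, rfl⟩ := hm.two_dvd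
    rw [(heven k).1, Nat.mul_div_cancel_left _ two_pos]
  · obtain ⟨k, rfl⟩ := Nat.not_even_iff_odd.1 hm
    exact (heven k).2

/-- Euler's identity `e_{q⁴}(-z²) = 1 / (-z²; q⁴)_∞`. The Taylor series of the right side inherits
its functional equation and is identified by `gaussPS_unique`. -/
theorem realizes_gauss (hq0 : 0 < q) (hq1 : q < 1) : Realizes (gaussPS q) (gaussFun q) := by
  refine ⟨?_, 1, one_pos, analyticOnNhd_gaussFun hq0 hq1⟩
  obtain ⟨p, hp⟩ := analyticOnNhd_gaussFun hq0 hq1 0 (by simp)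
  rw [hasFPowerSeriesAt_iff] at hp
  set φ : PowerSeries ℂ := PowerSeries.mk p.coeff with hφ
  have hsum : ∀ᶠ z in 𝓝 (0 : ℂ), HasSum (fun m => PowerSeries.coeff m φ * z ^ m)
      (gaussFun q z) := by
    filter_upwards [hp] with z hz
    simpa only [hφ, PowerSeries.coeff_mk, smul_eq_mul, zero_add, mul_comm] using hz
  have h0 : PowerSeries.coeff 0 φ = 1 := by
    have h1 := hsum.self_of_nhds
    have h2 : HasSum (fun m => PowerSeries.coeff m φ * (0 : ℂ) ^ m) (PowerSeries.coeff 0 φ) := by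
      have := hasSum_single (f := fun m => PowerSeries.coeff m φ * (0 : ℂ) ^ m) 0
        fun m hm => by simp [hm]
      simpa using this
    rw [h2.unique h1, gaussFun_zero]
  have him : ∀ᶠ z in 𝓝 (0 : ℂ), |z.im| < 1 := by
    have : Continuous fun z : ℂ => |z.im| := by fun_prop
    exact this.continuousAt.eventually_lt continuousAt_const (by simp)
  rw [← gaussPS_unique hq0 hq1 h0]
  · exact hsum
  · refine powerSeries_unique (hasSum_coeff_rescale hsum _) ?_
    filter_upwards [hsum, him, (Realizes.pow_X 2).1] with z hz hi hX
    rw [gaussFun_mul hq0 hq1 hi]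
    have := hz.add (hasSum_coeff_mul hz hX)
    simp only [map_add, add_mul]
    convert this using 1
    ring

/-! ### Several variables -/

theorem hasSum_mul_prod {ι κ : Type*} {f : ι → ℂ} {g : κ → ℂ} {s t : ℂ} (hf : HasSum f s)
    (hg : HasSum g t) : HasSum (fun p : ι × κ => f p.1 * g p.2) (s * t) := by
  have h1 : Summable fun i => ‖f i‖ := hf.summable.norm
  have h2 : Summable fun i => ‖g i‖ := hg.summable.norm
  exact HasSum.mul hf hg (summable_mul_of_summable_norm h1 h2)

theorem hasSum_prod_fin {ι : Type*} {n : ℕ} {g : Fin n → ι → ℂ} {s : Fin n → ℂ}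
    (hg : ∀ j, HasSum (g j) (s j)) :
    HasSum (fun p : Fin n → ι => ∏ j, g j (p j)) (∏ j, s j) := by
  induction n with
  | zero => simp
  | succ n ih =>
    have h := ih fun j => hg j.succ
    rw [← (Fin.consEquiv fun _ : Fin (n + 1) => ι).hasSum_iff, Fin.prod_univ_succ]
    have := hasSum_mul_prod (hg 0) h
    convert this using 1
    funext p
    simp [Fin.prod_univ_succ]

/-- Near `0` the multiple series is a product of absolutely convergent series; the tube is the
product of the one-variable strips. -/
theorem isRealization_sep {φ : Fin n → PowerSeries ℂ} {F : Fin n → ℂ → ℂ}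
    (h : ∀ j, Realizes (φ j) (F j)) :
    IsRealization (sep _ φ : Cov q n) fun z => ∏ j, F j (z j) := by
  constructor
  · have : ∀ᶠ z in 𝓝 (0 : Fin n → ℂ), ∀ j,
        HasSum (fun m => PowerSeries.coeff m (φ j) * z j ^ m) (F j (z j)) :=
      eventually_all.2 fun j => by
        have ht : Tendsto (fun z : Fin n → ℂ => z j) (𝓝 0) (𝓝 0) :=
          (continuous_apply j).tendsto' 0 0 rfl
        exact ht.eventually (h j).1
    filter_upwards [this] with z hz
    rw [← Finsupp.equivFunOnFinite.symm.hasSum_iff]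
    convert hasSum_prod_fin hz using 1
    funext E
    simp [coeff_sep, Finset.prod_mul_distrib]
  · choose r hr ha using fun j => (h j).2
    refine ⟨{y | ∀ j, |y j| < r j}, ?_, by simpa using hr, fun z hz => ?_⟩
    · simp only [Set.ofPred_forall]
      exact isOpen_iInter_of_finite fun j => isOpen_lt (by fun_prop) continuous_const
    · refine Finset.analyticAt_fun_prod _ fun j _ => ?_
      exact (ha j (z j) (hz j)).comp_of_eq
        ((ContinuousLinearMap.proj (R := ℂ) (φ := fun _ : Fin n => ℂ) j).analyticAt z) rfl

/-- Makes `realization` independent of the chosen continuation. The two tubes may have disconnected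
bases, so the identity theorem is applied over a ball inside both, where the tube is convex. -/
theorem IsRealization.eq_on_real {f : Cov q n} {F G : (Fin n → ℂ) → ℂ} (hF : IsRealization f F)
    (hG : IsRealization f G) (z : Fin n → ℝ) :
    F (fun j => (z j : ℂ)) = G (fun j => (z j : ℂ)) := by
  obtain ⟨h1, U, hU, hU0, hFa⟩ := hF
  obtain ⟨h2, V, hV, hV0, hGa⟩ := hG
  obtain ⟨ε, hε, hball⟩ := Metric.isOpen_iff.1 (hU.inter hV) 0 ⟨hU0, hV0⟩
  set L : (Fin n → ℂ) →ₗ[ℝ] (Fin n → ℝ) := LinearMap.pi fun j =>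
    Complex.imLm ∘ₗ LinearMap.proj j with hL
  have hconv : Convex ℝ (L ⁻¹' Metric.ball 0 ε) := (convex_ball 0 ε).linear_preimage L
  have hmem : ∀ w ∈ L ⁻¹' Metric.ball 0 ε, (fun j => (w j).im) ∈ U ∩ V := fun w hw => hball hw
  refine AnalyticOnNhd.eqOn_of_preconnected_of_eventuallyEq (𝕜 := ℂ) (z₀ := 0)
    (hFa.mono fun w hw => (hmem w hw).1) (hGa.mono fun w hw => (hmem w hw).2)
    hconv.isPreconnected (by simpa using hε) ?_ ?_
  · filter_upwards [h1, h2] with w hw hw' using hw.unique hw'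
  · have : L (fun j => (z j : ℂ)) = 0 := by
      ext j
      simp [hL]
    simpa [this] using hε

theorem IsRealization.realization_eq {f : Cov q n} {F : (Fin n → ℂ) → ℂ}
    (hF : IsRealization f F) (z : Fin n → ℝ) : realization f z = F (fun j => (z j : ℂ)) := by
  have h : ∃ F, IsRealization f F := ⟨F, hF⟩
  rw [realization, dif_pos h]
  exact h.choose_spec.eq_on_real hF z

/-! ### The one-dimensional Jackson integral -/

theorem hasSum_of_eq {ι : Type*} {f g : ι → ℂ} {s t : ℂ} (h : HasSum f s)
    (hfg : ∀ i, g i = f i) (hst : t = s) : HasSum g t := by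
  rwa [hst, funext hfg]

/-- The terms of the bilateral Jackson sum of `w` over the `q²`-lattice through `±c`. -/
def jterm (q : ℝ) (w : ℂ → ℂ) (c : ℝ) (u : ℤ × ℤˣ) : ℂ :=
  (q : ℂ) ^ (2 * u.1) * w ((((u.2 : ℤ) : ℝ) * q ^ (2 * u.1) * c : ℝ) : ℂ)

/-- Multiplying the base point by `q^{2m}` maps the lattice to itself; only the Jackson weights
change. -/
theorem hasSum_jterm_scale (hq0 : 0 < q) {w : ℂ → ℂ} {c : ℝ} {s : ℂ}
    (h : HasSum (jterm q w c) s) (m : ℤ) :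
    HasSum (jterm q w (q ^ (2 * m) * c)) ((q : ℂ) ^ (-(2 * m)) * s) := by
  have hq : (q : ℂ) ≠ 0 := Complex.ofReal_ne_zero.2 hq0.ne'
  refine hasSum_of_eq (((((Equiv.addRight m).prodCongr (Equiv.refl ℤˣ)).hasSum_iff).2 h).mul_left
    ((q : ℂ) ^ (-(2 * m)))) (fun u => ?_) rfl
  simp only [jterm, Function.comp_apply, Equiv.prodCongr_apply, Prod.map_fst, Prod.map_snd,
    Equiv.coe_addRight, Equiv.refl_apply]
  rw [← mul_assoc ((q : ℂ) ^ (-(2 * m))), ← zpow_add₀ hq]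
  congr 2
  · ring
  · rw [mul_add, zpow_add₀ hq0.ne']
    congr 1
    ring

theorem hasSum_jterm_neg {w : ℂ → ℂ} {c : ℝ} {s : ℂ} (h : HasSum (jterm q w c) s) :
    HasSum (jterm q (fun z => w (-z)) c) s := by
  have := (((Equiv.refl ℤ).prodCongr (Equiv.neg ℤˣ)).hasSum_iff).2 h
  convert this using 1
  funext u
  simp [jterm]

/-- The lattice is symmetric under `z ↦ -z`, so passing to the even part does not change the sum. -/
theorem hasSum_jterm_even {w : ℂ → ℂ} {c : ℝ} {s : ℂ} (h : HasSum (jterm q w c) s) :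
    HasSum (jterm q (fun z => 2⁻¹ * (w z + w (-z))) c) s := by
  refine hasSum_of_eq ((h.add (hasSum_jterm_neg h)).mul_left 2⁻¹) (fun u => ?_) ?_
  · simp only [jterm]
    ring
  · ring

theorem summable_jterm_of_int {w : ℂ → ℂ} {c : ℝ}
    (h : ∀ ε : ℤˣ, Summable fun k : ℤ => jterm q w c (k, ε)) : Summable (jterm q w c) := by
  rw [← summable_norm_iff, ← (Equiv.prodComm ℤˣ ℤ).summable_iff]
  refine (summable_prod_of_nonneg fun _ => norm_nonneg _).2 ⟨fun ε => (h ε).norm, ?_⟩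
  exact Summable.of_finite

/-! ### Moments of the Hermite weights -/

/-- `z^e e_{q⁴}(-z²) h̃_a(z; q²)`. -/
def hermiteWeight (q : ℝ) (a e : ℕ) (z : ℂ) : ℂ :=
  z ^ e * (gaussFun q z * hermiteII (q ^ 2) a z)

theorem gaussFun_real (hq0 : 0 < q) (hq1 : q < 1) (y : ℝ) :
    gaussFun q ((q ^ 2 * y : ℝ) : ℂ) = (1 + (y : ℂ) ^ 2) * gaussFun q y := by
  push_cast
  exact gaussFun_mul hq0 hq1 (by simp)

/-- Ratio test in both directions. By the functional equation, consecutive terms have ratio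
`q^{2+2e} (1 + (q^{2k} c)²)` in norm. It tends to `q^{2+2e} < 1` as `k → ∞`, and it is unbounded as
`k → -∞`, so the terms decay there as well. -/
theorem summable_gauss_int (hq0 : 0 < q) (hq1 : q < 1) {c : ℝ} (hc : c ≠ 0) (e : ℕ) :
    Summable fun k : ℤ => (q : ℂ) ^ (2 * k) *
      (((q ^ (2 * k) * c : ℝ) : ℂ) ^ e * gaussFun q ((q ^ (2 * k) * c : ℝ) : ℂ)) := by
  set f : ℤ → ℂ := fun k => (q : ℂ) ^ (2 * k) *
      (((q ^ (2 * k) * c : ℝ) : ℂ) ^ e * gaussFun q ((q ^ (2 * k) * c : ℝ) : ℂ)) with hf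
  have hq : (q : ℂ) ≠ 0 := Complex.ofReal_ne_zero.2 hq0.ne'
  have hrec : ∀ k, ‖f (k + 1)‖ = q ^ (2 + 2 * e) * (1 + (q ^ (2 * k) * c) ^ 2) * ‖f k‖ := by
    intro k
    have hk : q ^ (2 * (k + 1)) * c = q ^ 2 * (q ^ (2 * k) * c) := by
      rw [mul_add, zpow_add₀ hq0.ne', mul_one]
      norm_cast
      ring
    have hk' : (q : ℂ) ^ (2 * (k + 1)) = (q : ℂ) ^ 2 * (q : ℂ) ^ (2 * k) := by
      rw [mul_add, zpow_add₀ hq, mul_one]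
      norm_cast
      ring
    have : f (k + 1) = ((q ^ (2 + 2 * e) * (1 + (q ^ (2 * k) * c) ^ 2) : ℝ) : ℂ) * f k := by
      simp only [hf]
      rw [hk, gaussFun_real hq0 hq1, hk']
      push_cast
      ring
    rw [this, norm_mul, Complex.norm_real, Real.norm_of_nonneg (by positivity)]
  have hq2 : q ^ 2 < 1 := pow_lt_one₀ hq0.le hq1 two_ne_zero
  have hpow : Tendsto (fun m : ℕ => (q ^ 2) ^ m) atTop (𝓝 0) :=
    tendsto_pow_atTop_nhds_zero_of_lt_one (by positivity) hq2
  have hzpow : ∀ m : ℕ, q ^ (2 * (m : ℤ)) = (q ^ 2) ^ m := fun m => by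
    rw [← pow_mul]
    exact_mod_cast zpow_natCast q (2 * m)
  refine Summable.of_nat_of_neg ?_ ?_
  · refine summable_of_ratio_norm_eventually_le (r := (1 + q ^ 2) / 2) (by linarith) ?_
    have ht : Tendsto (fun m : ℕ => q ^ 2 * (1 + ((q ^ 2) ^ m * c) ^ 2)) atTop
        (𝓝 (q ^ 2 * (1 + (0 * c) ^ 2))) := (((hpow.mul_const c).pow 2).const_add 1).const_mul _
    have hlt : q ^ 2 * (1 + (0 * c) ^ 2) < (1 + q ^ 2) / 2 := by
      simp only [zero_mul]
      linarith
    filter_upwards [ht.eventually_lt_const hlt] with m hm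
    have := hrec m
    push_cast
    rw [this, hzpow]
    refine mul_le_mul_of_nonneg_right (le_trans ?_ hm.le) (norm_nonneg _)
    have : q ^ (2 + 2 * e) ≤ q ^ 2 := pow_le_pow_of_le_one hq0.le hq1.le (by omega)
    gcongr
  · refine summable_of_ratio_norm_eventually_le (r := 1 / 2) (by norm_num) ?_
    have ht : Tendsto (fun m : ℕ => ((q ^ 2) ^ (m + 1)) ^ 2) atTop (𝓝 0) := by
      simpa using (hpow.comp (tendsto_add_atTop_nat 1)).pow 2
    have hpos : 0 < q ^ (2 + 2 * e) * c ^ 2 / 2 := by positivity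
    filter_upwards [ht.eventually_lt_const hpos] with m hm
    have := hrec (-((m + 1 : ℕ) : ℤ))
    rw [show -((m + 1 : ℕ) : ℤ) + 1 = -(m : ℤ) by push_cast; ring] at this
    rw [this]
    set t := (q ^ 2) ^ (m + 1) with ht'
    have htpos : 0 < t := by positivity
    have hz : q ^ (2 * -((m + 1 : ℕ) : ℤ)) = t⁻¹ := by
      rw [mul_neg, zpow_neg, hzpow]
    rw [hz]
    have hkey : 2 ≤ q ^ (2 + 2 * e) * (1 + (t⁻¹ * c) ^ 2) := by
      have h1 : 2 * t ^ 2 ≤ q ^ (2 + 2 * e) * c ^ 2 := by linarith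
      have h2 : 2 ≤ q ^ (2 + 2 * e) * c ^ 2 / t ^ 2 := by
        rw [le_div_iff₀ (by positivity)]
        exact h1
      have h3 : q ^ (2 + 2 * e) * (1 + (t⁻¹ * c) ^ 2) =
          q ^ (2 + 2 * e) + q ^ (2 + 2 * e) * c ^ 2 / t ^ 2 := by
        field_simp
      have : 0 < q ^ (2 + 2 * e) := by positivity
      linarith
    nlinarith [norm_nonneg (f (-((m + 1 : ℕ) : ℤ)))]

theorem summable_jterm_gauss (hq0 : 0 < q) (hq1 : q < 1) {c : ℝ} (hc : c ≠ 0) (e : ℕ) :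
    Summable (jterm q (fun z => z ^ e * gaussFun q z) c) := by
  refine summable_jterm_of_int fun ε => ?_
  have hε : ((ε : ℤ) : ℝ) * c ≠ 0 := mul_ne_zero (by exact_mod_cast ε.ne_zero) hc
  refine (summable_gauss_int hq0 hq1 hε e).congr fun k => ?_
  simp only [jterm]
  rw [show ((ε : ℤ) : ℝ) * q ^ (2 * k) * c = q ^ (2 * k) * (((ε : ℤ) : ℝ) * c) by ring]

theorem summable_jterm_hermiteWeight (hq0 : 0 < q) (hq1 : q < 1) {c : ℝ} (hc : c ≠ 0)
    (a e : ℕ) : Summable (jterm q (hermiteWeight q a e) c) := by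
  have : jterm q (hermiteWeight q a e) c = fun u => ∑ k ∈ Finset.range (a / 2 + 1),
      (hermiteIICoeff (q ^ 2) a k : ℂ) *
        jterm q (fun z => z ^ (e + (a - 2 * k)) * gaussFun q z) c u := by
    funext u
    simp only [jterm, hermiteWeight]
    rw [hermiteII_eq_sum _ _ _ (Nat.lt_succ_self _)]
    simp only [Finset.mul_sum, Nat.succ_eq_add_one]
    refine Finset.sum_congr rfl fun k _ => ?_
    rw [pow_add]
    ring
  rw [this]
  exact summable_sum fun k _ => (summable_jterm_gauss hq0 hq1 hc _).mul_left _

/-- The functional equation of the Gaussian and `hermiteII_succ` combine to a `q²`-difference; the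
factor `q^{-2e}` compensates the scaling of `z^e`. -/
theorem hermiteWeight_succ (hq0 : 0 < q) (hq1 : q < 1) (a e : ℕ) (y : ℝ) :
    hermiteWeight q (a + 1) (e + 1) y = (q : ℂ) ^ (-(2 * (a : ℤ))) *
      ((q : ℂ) ^ (-(2 * (e : ℤ))) * hermiteWeight q a e ((q ^ 2 * y : ℝ) : ℂ) -
        hermiteWeight q a e y) := by
  have hq : (q : ℂ) ≠ 0 := Complex.ofReal_ne_zero.2 hq0.ne'
  have h := hermiteII_succ (p := q ^ 2) (by positivity) (pow_lt_one₀ hq0.le hq1 two_ne_zero) a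
    (y : ℂ)
  have hz : ∀ m : ℕ, (q : ℂ) ^ (-(2 * (m : ℤ))) = (((q : ℂ) ^ 2) ^ m)⁻¹ := fun m => by
    rw [zpow_neg, ← pow_mul]
    exact_mod_cast congrArg (·⁻¹) (zpow_natCast (q : ℂ) (2 * m))
  simp only [hermiteWeight]
  rw [gaussFun_real hq0 hq1, hz, hz]
  push_cast at h ⊢
  rw [mul_pow _ (y : ℂ) e]
  have : ((q : ℂ) ^ 2) ^ e ≠ 0 := pow_ne_zero _ (pow_ne_zero _ hq)
  have : ((q : ℂ) ^ 2) ^ a ≠ 0 := pow_ne_zero _ (pow_ne_zero _ hq)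
  field_simp
  linear_combination -(y : ℂ) ^ e * gaussFun q y * h

/-- The bilateral Jackson sum of `z^e e_{q⁴}(-z²) h̃_a(z; q²)`. -/
def moment (q : ℝ) (a e : ℕ) (c : ℝ) : ℂ := ∑' u, jterm q (hermiteWeight q a e) c u

theorem hasSum_moment (hq0 : 0 < q) (hq1 : q < 1) {c : ℝ} (hc : c ≠ 0) (a e : ℕ) :
    HasSum (jterm q (hermiteWeight q a e) c) (moment q a e c) :=
  (summable_jterm_hermiteWeight hq0 hq1 hc a e).hasSum

theorem moment_scale (hq0 : 0 < q) (hq1 : q < 1) {c : ℝ} (hc : c ≠ 0) (a e : ℕ) (m : ℤ) :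
    moment q a e (q ^ (2 * m) * c) = (q : ℂ) ^ (-(2 * m)) * moment q a e c :=
  (hasSum_jterm_scale hq0 (hasSum_moment hq0 hq1 hc a e) m).tsum_eq

/-- In `hermiteWeight_succ`, the term evaluated at `q² y` sums over the lattice through `q² c`,
which costs `q^{-2}` by `hasSum_jterm_scale`. -/
theorem moment_succ_succ (hq0 : 0 < q) (hq1 : q < 1) {c : ℝ} (hc : c ≠ 0) (a e : ℕ) :
    moment q (a + 1) (e + 1) c = (q : ℂ) ^ (-(2 * (a : ℤ))) *
      ((q : ℂ) ^ (-(2 * ((e + 1 : ℕ) : ℤ))) - 1) * moment q a e c := by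
  have hq : (q : ℂ) ≠ 0 := Complex.ofReal_ne_zero.2 hq0.ne'
  have h := hasSum_moment hq0 hq1 hc a e
  have h1 := hasSum_jterm_scale hq0 h 1
  have h2 := ((h1.mul_left ((q : ℂ) ^ (-(2 * (e : ℤ))))).sub h).mul_left
    ((q : ℂ) ^ (-(2 * (a : ℤ))))
  refine (HasSum.unique (f := jterm q (hermiteWeight q (a + 1) (e + 1)) c)
    (hasSum_moment hq0 hq1 hc _ _) (hasSum_of_eq h2 (fun u => ?_) ?_))
  · simp only [jterm]
    rw [hermiteWeight_succ hq0 hq1]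
    rw [show (((u.2 : ℤ) : ℝ) * q ^ (2 * u.1) * (q ^ (2 * (1 : ℤ)) * c)) =
      q ^ 2 * (((u.2 : ℤ) : ℝ) * q ^ (2 * u.1) * c) by
        rw [mul_one]
        norm_cast
        ring]
    ring
  · have : (q : ℂ) ^ (-(2 * ((e + 1 : ℕ) : ℤ))) =
        (q : ℂ) ^ (-(2 * (e : ℤ))) * (q : ℂ) ^ (-(2 * (1 : ℤ))) := by
      rw [← zpow_add₀ hq]
      congr 1
      push_cast
      ring
    rw [this]
    ring

theorem hasSum_nat_telescope {v : ℕ → ℂ} {l : ℂ} (hs : Summable fun m => v (m + 1) - v m)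
    (h : Tendsto v atTop (𝓝 l)) : HasSum (fun m => v (m + 1) - v m) (l - v 0) := by
  have h1 := hs.hasSum.tendsto_sum_nat
  simp only [Finset.sum_range_sub] at h1
  have h2 : Tendsto (fun m => v m - v 0) atTop (𝓝 (l - v 0)) := h.sub tendsto_const_nhds
  rw [← tendsto_nhds_unique h1 h2]
  exact hs.hasSum

theorem hasSum_int_telescope {v : ℤ → ℂ} (hs : Summable fun k => v (k + 1) - v k)
    (h1 : Tendsto (fun m : ℕ => v m) atTop (𝓝 0))
    (h2 : Tendsto (fun m : ℕ => v (-(m : ℤ))) atTop (𝓝 0)) :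
    HasSum (fun k => v (k + 1) - v k) 0 := by
  have e1 : HasSum (fun m : ℕ => v ((m : ℤ) + 1) - v m) (0 - v 0) :=
    hasSum_nat_telescope (v := fun m : ℕ => v m)
      (hs.comp_injective (i := fun m : ℕ => (m : ℤ)) Nat.cast_injective) h1
  have hinj : Function.Injective fun m : ℕ => -((m : ℤ) + 1) := fun a b hab => by
    have : -((a : ℤ) + 1) = -((b : ℤ) + 1) := hab
    omega
  have hs2 : Summable fun m : ℕ => v (-((m : ℤ) + 1) + 1) - v (-((m : ℤ) + 1)) :=
    hs.comp_injective hinj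
  have hflip : ∀ m : ℕ, v (-((m : ℤ) + 1) + 1) - v (-((m : ℤ) + 1)) =
      -(v (-((m + 1 : ℕ) : ℤ)) - v (-(m : ℤ))) := fun m => by
    rw [neg_sub, show -((m : ℤ) + 1) + 1 = -(m : ℤ) by ring]
    push_cast
    rfl
  have hs3 : Summable fun m : ℕ => v (-((m + 1 : ℕ) : ℤ)) - v (-(m : ℤ)) := by
    refine hs2.neg.congr fun m => ?_
    rw [hflip, neg_neg]
  have e2 : HasSum (fun m : ℕ => v (-((m : ℤ) + 1) + 1) - v (-((m : ℤ) + 1))) (v 0) := by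
    have h3 := hasSum_nat_telescope (v := fun m : ℕ => v (-(m : ℤ))) hs3 h2
    exact hasSum_of_eq h3.neg hflip (by simp)
  have e3 := HasSum.of_nat_of_neg_add_one (f := fun k : ℤ => v (k + 1) - v k) e1 e2
  rwa [zero_sub, neg_add_cancel] at e3

/-- Divide `hermiteWeight_succ` with `e = 0` by `y`: the factor `1/y` cancels the Jackson weight
`q^{2k}`, and the sum telescopes. -/
theorem moment_succ_zero (hq0 : 0 < q) (hq1 : q < 1) {c : ℝ} (hc : c ≠ 0) (a : ℕ) :
    moment q (a + 1) 0 c = 0 := by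
  have hq : (q : ℂ) ≠ 0 := Complex.ofReal_ne_zero.2 hq0.ne'
  set w : ℂ → ℂ := hermiteWeight q a 0 with hw
  -- Both signs are combined because `w` need not vanish at `0`: the limits `w 0` as `k → ∞` cancel
  -- in the difference.
  set v : ℤ → ℂ := fun k => w ((q ^ (2 * k) * c : ℝ) : ℂ) - w ((-(q ^ (2 * k) * c) : ℝ) : ℂ) with hv
  have hsum := hasSum_moment hq0 hq1 hc (a + 1) 0
  have hterm : ∀ (k : ℤ) (ε : ℤˣ), jterm q (hermiteWeight q (a + 1) 0) c (k, ε) =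
      (q : ℂ) ^ (-(2 * (a : ℤ))) * (c : ℂ)⁻¹ * ((ε : ℤ) : ℂ) *
        (w ((((ε : ℤ) : ℝ) * (q ^ (2 * (k + 1)) * c) : ℝ) : ℂ) -
          w ((((ε : ℤ) : ℝ) * (q ^ (2 * k) * c) : ℝ) : ℂ)) := by
    intro k ε
    have h := hermiteWeight_succ hq0 hq1 a 0 (((ε : ℤ) : ℝ) * q ^ (2 * k) * c)
    have hmul : ∀ y : ℝ, hermiteWeight q (a + 1) (0 + 1) y = y * hermiteWeight q (a + 1) 0 y :=
      fun y => by
        simp only [hermiteWeight]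
        ring
    rw [hmul] at h
    have hε : ((ε : ℤ) : ℂ) * ((ε : ℤ) : ℂ) = 1 := by
      rcases Int.units_eq_one_or ε with rfl | rfl <;> simp
    have hqk : (q : ℂ) ^ (2 * k) ≠ 0 := zpow_ne_zero _ hq
    have hcc : (c : ℂ) ≠ 0 := Complex.ofReal_ne_zero.2 hc
    rw [show ((ε : ℤ) : ℝ) * (q ^ (2 * (k + 1)) * c) =
      q ^ 2 * (((ε : ℤ) : ℝ) * q ^ (2 * k) * c) by
        rw [mul_add, zpow_add₀ hq0.ne', mul_one]
        norm_cast
        ring,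
      show ((ε : ℤ) : ℝ) * (q ^ (2 * k) * c) = ((ε : ℤ) : ℝ) * q ^ (2 * k) * c by ring]
    simp only [jterm, hw]
    generalize hermiteWeight q (a + 1) 0 ((((ε : ℤ) : ℝ) * q ^ (2 * k) * c : ℝ) : ℂ) = X at h ⊢
    generalize hermiteWeight q a 0 ((((ε : ℤ) : ℝ) * q ^ (2 * k) * c : ℝ) : ℂ) = Y at h ⊢
    generalize hermiteWeight q a 0 ((q ^ 2 * (((ε : ℤ) : ℝ) * q ^ (2 * k) * c) : ℝ) : ℂ) = Z
      at h ⊢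
    push_cast at h
    simp only [neg_zero, zpow_zero, one_mul] at h
    rw [show (q : ℂ) ^ (-(2 * (a : ℤ))) * (c : ℂ)⁻¹ * ((ε : ℤ) : ℂ) * (Z - Y) =
      (c : ℂ)⁻¹ * ((ε : ℤ) : ℂ) * ((q : ℂ) ^ (-(2 * (a : ℤ))) * (Z - Y)) by ring, ← h]
    rw [show (c : ℂ)⁻¹ * ((ε : ℤ) : ℂ) * (((ε : ℤ) : ℂ) * (q : ℂ) ^ (2 * k) * c * X) =
      (((ε : ℤ) : ℂ) * ((ε : ℤ) : ℂ)) * ((c : ℂ) * (c : ℂ)⁻¹) * ((q : ℂ) ^ (2 * k) * X) by ring,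
      hε, mul_inv_cancel₀ hcc, one_mul, one_mul]
  set K : ℂ := (q : ℂ) ^ (-(2 * (a : ℤ))) * (c : ℂ)⁻¹ with hK
  have hK0 : K ≠ 0 :=
    mul_ne_zero (zpow_ne_zero _ hq) (inv_ne_zero (Complex.ofReal_ne_zero.2 hc))
  have hfib : HasSum (fun k : ℤ => K * (v (k + 1) - v k)) (moment q (a + 1) 0 c) := by
    refine hasSum_of_eq (hsum.prod_fiberwise fun k => hasSum_fintype _) (fun k => ?_) rfl
    rw [UnitsInt.univ, Finset.sum_pair (by decide), hterm, hterm]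
    simp only [hv, Units.val_one, Units.val_neg, Int.cast_one, Int.cast_neg, one_mul, neg_mul]
    ring
  have hvs : Summable fun k => v (k + 1) - v k := (summable_mul_left_iff hK0).1 hfib.summable
  have hcont : ContinuousAt w 0 := by
    have h1 : ContinuousAt (gaussFun q) 0 :=
      (analyticOnNhd_gaussFun hq0 hq1 0 (by simp)).continuousAt
    have h2 : Continuous fun z : ℂ => hermiteII (q ^ 2) a z := by
      simp only [hermiteII, smul_eq_mul]
      fun_prop
    exact (continuousAt_id.pow 0).mul (h1.mul h2.continuousAt)
  have hpow : Tendsto (fun m : ℕ => q ^ (2 * (m : ℤ))) atTop (𝓝 0) := by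
    have h := tendsto_pow_atTop_nhds_zero_of_lt_one (r := q ^ 2) (by positivity)
      (pow_lt_one₀ hq0.le hq1 two_ne_zero)
    refine h.congr fun m => ?_
    rw [← pow_mul]
    exact_mod_cast (zpow_natCast q (2 * m)).symm
  have hplus : ∀ d : ℝ, Tendsto (fun m : ℕ => w ((q ^ (2 * (m : ℤ)) * d : ℝ) : ℂ)) atTop
      (𝓝 (w 0)) := by
    intro d
    refine hcont.tendsto.comp ?_
    have := (Complex.continuous_ofReal.tendsto 0).comp (by simpa using hpow.mul_const d)
    rw [Complex.ofReal_zero] at this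
    exact this
  -- Decay at infinity needs no further estimate: the summable Jackson terms tend to `0`, and for
  -- negative exponents their weight is at least `1`.
  have hminus : ∀ ε : ℤˣ, Tendsto (fun m : ℕ =>
      w ((((ε : ℤ) : ℝ) * q ^ (2 * -(m : ℤ)) * c : ℝ) : ℂ)) atTop (𝓝 0) := by
    intro ε
    have hs := (summable_jterm_hermiteWeight hq0 hq1 hc a 0).comp_injective
      (i := fun m : ℕ => ((-(m : ℤ), ε) : ℤ × ℤˣ)) fun m m' h => by
        have := (Prod.ext_iff.1 h).1
        simpa using this
    refine squeeze_zero_norm (fun m => ?_) (tendsto_zero_iff_norm_tendsto_zero.1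
      hs.tendsto_atTop_zero)
    simp only [Function.comp_apply, jterm, norm_mul, norm_zpow, Complex.norm_real,
      Real.norm_of_nonneg hq0.le]
    refine le_mul_of_one_le_left (norm_nonneg _) ?_
    rw [mul_neg, zpow_neg]
    refine (one_le_inv₀ (by positivity)).2 ?_
    exact_mod_cast pow_le_one₀ hq0.le hq1.le (n := 2 * m)
  have htel := hasSum_int_telescope hvs
    (by simpa [hv] using (hplus c).sub (hplus (-c)))
    (by simpa [hv] using (hminus 1).sub (hminus (-1)))
  simpa using hfib.unique (htel.mul_left K)

/-- The ratios of the moments of the discrete Hermite weights to the mass of the Gaussian. -/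
def momentRatio (q : ℝ) (a e : ℕ) : ℂ :=
  if a ≤ e ∧ Even (e - a) then
    (qPoch (q ^ 2) (q ^ 2) e : ℂ) / (qPoch (q ^ 4) (q ^ 4) ((e - a) / 2) : ℂ) *
      (q : ℂ) ^ (-(e : ℤ) ^ 2 - e + a - (a : ℤ) ^ 2 + 2 * (((e - a) / 2 : ℕ) : ℤ) ^ 2 +
        2 * (((e - a) / 2 : ℕ) : ℤ))
  else 0

theorem momentRatio_succ_succ (hq0 : 0 < q) (a e : ℕ) :
    momentRatio q (a + 1) (e + 1) = (q : ℂ) ^ (-(2 * (a : ℤ))) *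
      ((q : ℂ) ^ (-(2 * ((e + 1 : ℕ) : ℤ))) - 1) * momentRatio q a e := by
  have hq : (q : ℂ) ≠ 0 := Complex.ofReal_ne_zero.2 hq0.ne'
  simp only [momentRatio, Nat.add_sub_add_right, Nat.add_le_add_iff_right]
  split_ifs with h
  · rw [qPoch_self_succ]
    generalize (e - a) / 2 = k
    push_cast
    have h1 : ((q : ℂ) ^ 2) ^ (e + 1) = (q : ℂ) ^ (2 * ((e : ℤ) + 1)) := by
      rw [← pow_mul, ← zpow_natCast]
      push_cast
      rfl
    have h2 : (q : ℂ) ^ (-((e : ℤ) + 1) ^ 2 - (e + 1) + (a + 1) - ((a : ℤ) + 1) ^ 2 + 2 * (k : ℤ) ^ 2 +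
        2 * k) = (q : ℂ) ^ (-(2 * (a : ℤ))) * (q : ℂ) ^ (-(2 * ((e : ℤ) + 1))) *
        (q : ℂ) ^ (-(e : ℤ) ^ 2 - e + a - (a : ℤ) ^ 2 + 2 * (k : ℤ) ^ 2 + 2 * k) := by
      rw [← zpow_add₀ hq, ← zpow_add₀ hq]
      congr 1
      ring
    have h3 : (q : ℂ) ^ (2 * ((e : ℤ) + 1)) * (q : ℂ) ^ (-(2 * ((e : ℤ) + 1))) = 1 := by
      rw [← zpow_add₀ hq, add_neg_cancel, zpow_zero]
    rw [h1, h2]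
    linear_combination -(qPoch (q ^ 2) (q ^ 2) e : ℂ) /
      (qPoch (q ^ 4) (q ^ 4) k : ℂ) * (q : ℂ) ^ (-(2 * (a : ℤ))) *
      (q : ℂ) ^ (-(e : ℤ) ^ 2 - e + a - (a : ℤ) ^ 2 + 2 * (k : ℤ) ^ 2 + 2 * k) * h3
  · rw [mul_zero]

theorem momentRatio_zero_succ_succ (hq0 : 0 < q) (hq1 : q < 1) (e : ℕ) :
    momentRatio q 0 (e + 2) =
      ((q : ℂ) ^ (-(2 * ((e + 1 : ℕ) : ℤ))) - 1) * momentRatio q 0 e := by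
  have hq : (q : ℂ) ≠ 0 := Complex.ofReal_ne_zero.2 hq0.ne'
  simp only [momentRatio, Nat.sub_zero, Nat.zero_le, true_and, Nat.even_add, even_two, iff_true]
  split_ifs with h
  · obtain ⟨k, rfl⟩ := h.two_dvd
    rw [show (2 * k + 2) / 2 = k + 1 by omega, Nat.mul_div_cancel_left _ two_pos]
    have hP0 : 0 < q ^ 4 := by positivity
    have hP1 : q ^ 4 < 1 := pow_lt_one₀ hq0.le hq1 four_ne_zero
    have hne : ∀ k, (qPoch (q ^ 4) (q ^ 4) k : ℂ) ≠ 0 := fun k =>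
      Complex.ofReal_ne_zero.2 (qPoch_self_ne_zero hP0 hP1 k)
    have hk := hne k
    have hk1 := hne (k + 1)
    rw [qPoch_self_succ] at hk1 ⊢
    rw [qPoch_self_succ, qPoch_self_succ]
    push_cast at hk1 ⊢
    have h1 : ((q : ℂ) ^ 4) ^ (k + 1) = ((q : ℂ) ^ 2) ^ (2 * k + 1 + 1) := by
      rw [← pow_mul, ← pow_mul]
      congr 1
      ring
    have h2 : (q : ℂ) ^ (-(2 * (k : ℤ) + 2) ^ 2 - (2 * k + 2) + 0 - 0 + 2 * ((k : ℤ) + 1) ^ 2 +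
        2 * (k + 1)) = (q : ℂ) ^ (-(2 * (2 * (k : ℤ) + 1))) *
        (q : ℂ) ^ (-(2 * (k : ℤ)) ^ 2 - 2 * k + 0 - 0 + 2 * (k : ℤ) ^ 2 + 2 * k) := by
      rw [← zpow_add₀ hq]
      congr 1
      ring
    have h3 : ((q : ℂ) ^ 2) ^ (2 * k + 1) * (q : ℂ) ^ (-(2 * (2 * (k : ℤ) + 1))) = 1 := by
      rw [show ((q : ℂ) ^ 2) ^ (2 * k + 1) = (q : ℂ) ^ (2 * (2 * (k : ℤ) + 1)) by
        rw [← pow_mul, ← zpow_natCast]; push_cast; rfl, ← zpow_add₀ hq, add_neg_cancel, zpow_zero]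
    rw [h1] at hk1 ⊢
    have hk2 := right_ne_zero_of_mul hk1
    rw [h2]
    generalize (q : ℂ) ^ (-(2 * (2 * (k : ℤ) + 1))) = Y at h3 ⊢
    generalize (q : ℂ) ^ (-(2 * (k : ℤ)) ^ 2 - 2 * k + 0 - 0 + 2 * (k : ℤ) ^ 2 + 2 * k) = Z
    generalize ((q : ℂ) ^ 2) ^ (2 * k + 1 + 1) = W at hk2 ⊢
    generalize ((q : ℂ) ^ 2) ^ (2 * k + 1) = V at h3 ⊢
    have hk2' : 1 - W ≠ 0 := hk2
    field_simp
    linear_combination -((qPoch (q ^ 2) (q ^ 2) (2 * k) : ℂ) * Z) * h3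
  · rw [mul_zero]

/-- Lowering both indices ends at `a = 0` or at a vanishing moment with `e = 0`. For `a = 0`, the
identity `h̃_1(z) = z` trades one power of `z` for one Hermite index, so the same recurrences
descend from `e + 2` to `e`. -/
theorem moment_eq (hq0 : 0 < q) (hq1 : q < 1) {c : ℝ} (hc : c ≠ 0) (a e : ℕ) :
    moment q a e c = momentRatio q a e * moment q 0 0 c := by
  have hp0 : 0 < q ^ 2 := by positivity
  have hp1 : q ^ 2 < 1 := pow_lt_one₀ hq0.le hq1 two_ne_zero
  have hshift : ∀ e, moment q 0 (e + 1) c = moment q 1 e c := by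
    intro e
    simp only [moment]
    refine tsum_congr fun u => ?_
    simp only [jterm, hermiteWeight, hermiteII_zero, hermiteII_one hp0 hp1]
    ring
  have hbase : ∀ e, moment q 0 e c = momentRatio q 0 e * moment q 0 0 c := by
    intro e
    induction e using Nat.twoStepInduction with
    | zero => simp [momentRatio, qPoch]
    | one =>
      rw [hshift, moment_succ_zero hq0 hq1 hc]
      simp [momentRatio]
    | more e ih _ =>
      rw [hshift, moment_succ_succ hq0 hq1 hc, ih, momentRatio_zero_succ_succ hq0 hq1]
      simp only [Nat.cast_zero, mul_zero, neg_zero, zpow_zero, one_mul]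
      ring
  induction a generalizing e with
  | zero => exact hbase e
  | succ a ih =>
    cases e with
    | zero =>
      rw [moment_succ_zero hq0 hq1 hc]
      simp [momentRatio]
    | succ e => rw [moment_succ_succ hq0 hq1 hc, ih, momentRatio_succ_succ hq0, ← mul_assoc]

/-! ### Integrals of separable series -/

theorem zpow_sum₀ {ι K : Type*} [Field K] {r : K} (hr : r ≠ 0) (t : Finset ι) (f : ι → ℤ) :
    r ^ (∑ i ∈ t, f i) = ∏ i ∈ t, r ^ f i := by
  classical
  induction t using Finset.induction_on with
  | empty => simp
  | insert i t hi ih => rw [Finset.sum_insert hi, Finset.prod_insert hi, zpow_add₀ hr, ih]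

/-- The lattice sum over `ℤⁿ × {±1}ⁿ` is regrouped as a product of sums over `ℤ × {±1}`. -/
theorem isIntegrable_sep {φ : Fin n → PowerSeries ℂ} {F : Fin n → ℂ → ℂ} (hq0 : 0 < q)
    (h : ∀ j, Realizes (φ j) (F j))
    (hs : ∀ j, ∀ c : ℝ, c ≠ 0 → Summable (jterm q (F j) c)) :
    IsIntegrable (sep _ φ : Cov q n) := by
  have hF := isRealization_sep (q := q) h
  refine ⟨⟨_, hF⟩, fun z hz => ?_⟩
  have hsum := (hasSum_prod_fin fun j => (hs j (z j) (hz j)).hasSum).summable.norm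
  rw [← (Equiv.arrowProdEquivProdArrow (Fin n) (fun _ => ℤ) fun _ => ℤˣ).summable_iff]
  refine (hsum.mul_left (∏ j, |z j|)).congr fun p => ?_
  simp only [Function.comp_apply, Equiv.arrowProdEquivProdArrow, Equiv.coe_fn_mk,
    hF.realization_eq, norm_prod, jterm, norm_mul, norm_zpow, Complex.norm_real,
    Real.norm_of_nonneg hq0.le, Finset.prod_mul_distrib]
  have hq : ∏ j, q ^ (2 * (p j).1) = q ^ (2 * ∑ j, (p j).1) := by
    rw [Finset.mul_sum, zpow_sum₀ hq0.ne']
  rw [hq]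
  ring

/-- The prefactor `x_1 ⋯ x_n` acts by `∏ γ_j` and moves the base point of the `j`-th lattice by
`q^{n-1-j}`. -/
theorem integral_sep (hq0 : 0 < q) {φ : Fin n → PowerSeries ℂ} {F : Fin n → ℂ → ℂ}
    (h : ∀ j, Realizes (φ j) (F j)) (b : Fin n → ℕ) (γ : Fin n → ℝ) {s : Fin n → ℂ}
    (hs : ∀ j, HasSum (jterm q (F j) (q ^ b j * (q ^ (n - 1 - (j : ℕ)) * γ j))) (s j)) :
    integral b (sep _ φ : Cov q n) γ =
      (1 - (q : ℂ) ^ 2) ^ n * (q : ℂ) ^ (n.choose 2 : ℤ) *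
        ∏ j, ((q : ℂ) ^ b j * γ j * s j) := by
  have hq : (q : ℂ) ≠ 0 := Complex.ofReal_ne_zero.2 hq0.ne'
  have hterm : ∀ p : (Fin n → ℤ) × (Fin n → ℤˣ),
      realization ((List.ofFn fun j => x q j).prod *
        rescale (fun j => ((p.2 j : ℤ) : ℂ) * (q : ℂ) ^ (2 * p.1 j + (b j : ℤ)))
          (sep _ φ : Cov q n)) γ =
      ∏ j, (F j ((((p.2 j : ℤ) : ℝ) * q ^ (2 * p.1 j) *
        (q ^ b j * (q ^ (n - 1 - (j : ℕ)) * γ j)) : ℝ) : ℂ) * γ j) := by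
    intro p
    have hr := isRealization_sep (q := q) fun j =>
      (((h j).rescale (((p.2 j : ℤ) : ℝ) * q ^ (2 * p.1 j + (b j : ℤ)))).rescale
        (q ^ (n - 1 - (j : ℕ)))).mul (Realizes.pow_X 1)
    rw [rescale_sep, prod_x_mul_sep]
    push_cast at hr
    simp only [pow_one] at hr
    rw [hr.realization_eq]
    refine Finset.prod_congr rfl fun j _ => ?_
    congr 2
    push_cast
    rw [zpow_add₀ hq, zpow_natCast]
    ring
  have hprod := hasSum_prod_fin fun j => (hs j).mul_left ((q : ℂ) ^ b j * γ j)
  rw [integral, ← (Equiv.arrowProdEquivProdArrow (Fin n) (fun _ => ℤ) fun _ => ℤˣ).tsum_eq,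
    ← hprod.tsum_eq, ← tsum_mul_left]
  refine tsum_congr fun p => ?_
  rw [hterm]
  simp only [Equiv.arrowProdEquivProdArrow, Equiv.coe_fn_mk, jterm, Finset.prod_mul_distrib]
  have e1 : ∏ j, (q : ℂ) ^ (2 * (p j).1) = (q : ℂ) ^ (2 * ∑ j, (p j).1) := by
    rw [Finset.mul_sum, zpow_sum₀ hq]
  have e2 : ∏ j, (q : ℂ) ^ b j = (q : ℂ) ^ (∑ j, (b j : ℤ)) := by
    rw [zpow_sum₀ hq]
    simp only [zpow_natCast]
  rw [e1, e2, zpow_add₀ hq, zpow_add₀ hq]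
  ring

/-! ### The transform of the Hermite Gaussian -/

theorem realizes_hermite (hq0 : 0 < q) (hq1 : q < 1) (a : ℕ) :
    Realizes (gaussPS q * hermiteII (q ^ 2) a PowerSeries.X)
      (fun z => gaussFun q z * hermiteII (q ^ 2) a z) :=
  (realizes_gauss hq0 hq1).mul (Realizes.hermiteII (q ^ 2) a)

/-- The function of one variable realizing a factor of `H x^E`. -/
def shiftedWeight (q : ℝ) (a e s : ℕ) (z : ℂ) : ℂ :=
  gaussFun q ((q : ℂ) ^ s * z) * hermiteII (q ^ 2) a ((q : ℂ) ^ s * z) * z ^ e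

theorem realizes_shiftedWeight (hq0 : 0 < q) (hq1 : q < 1) (a e s : ℕ) :
    Realizes (evenPS (PowerSeries.rescale ((q : ℂ) ^ s)
        (gaussPS q * hermiteII (q ^ 2) a PowerSeries.X) * PowerSeries.X ^ e))
      (fun z => 2⁻¹ * (shiftedWeight q a e s z + shiftedWeight q a e s (-z))) := by
  have h := (((realizes_hermite hq0 hq1 a).rescale (q ^ s)).mul (Realizes.pow_X e)).even
  push_cast at h
  exact h

/-- The rescaling moves the base point to `q^s c`. The power `z^e` was not rescaled, which leaves
the factor `q^{-se}`. -/
theorem hasSum_shiftedWeight (hq0 : 0 < q) (hq1 : q < 1) {c : ℝ} (hc : c ≠ 0) (a e s : ℕ) :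
    HasSum (jterm q (fun z => 2⁻¹ * (shiftedWeight q a e s z + shiftedWeight q a e s (-z))) c)
      (((q : ℂ) ^ (s * e))⁻¹ * moment q a e (q ^ s * c)) := by
  have hq : (q : ℂ) ≠ 0 := Complex.ofReal_ne_zero.2 hq0.ne'
  refine hasSum_jterm_even (hasSum_of_eq ((hasSum_moment hq0 hq1
    (mul_ne_zero (pow_ne_zero s hq0.ne') hc) a e).mul_left ((q : ℂ) ^ (s * e))⁻¹)
    (fun u => ?_) rfl)
  simp only [jterm, shiftedWeight, hermiteWeight]
  rw [show ((u.2 : ℤ) : ℝ) * q ^ (2 * u.1) * (q ^ s * c) =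
    q ^ s * (((u.2 : ℤ) : ℝ) * q ^ (2 * u.1) * c) by ring, Complex.ofReal_mul (q ^ s),
    Complex.ofReal_pow, mul_pow, ← pow_mul]
  have := pow_ne_zero (s * e) hq
  field_simp

theorem evenPart_hermiteGaussian_mul (a : Fin n → ℕ) (E : Fin n →₀ ℕ) :
    evenPart (hermiteGaussian q a * xMonomial q E) = sep _ fun j =>
      evenPS (PowerSeries.rescale ((q : ℂ) ^ (∑ k ∈ Finset.univ.filter (· < j), E k))
        (gaussPS q * hermiteII (q ^ 2) (a j) PowerSeries.X) * PowerSeries.X ^ E j) := by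
  rw [hermiteGaussian_eq_sep, sep_mul_xMonomial, evenPart_sep]

theorem classR_hermiteGaussian (hq0 : 0 < q) (hq1 : q < 1) (a : Fin n → ℕ) :
    ClassR (hermiteGaussian q a) := by
  intro E
  rw [evenPart_hermiteGaussian_mul]
  exact isIntegrable_sep hq0 (fun j => realizes_shiftedWeight hq0 hq1 _ _ _)
    fun j c hc => (hasSum_shiftedWeight hq0 hq1 hc _ _ _).summable

theorem hasSum_gaussFun (hq0 : 0 < q) (hq1 : q < 1) {c : ℝ} (hc : c ≠ 0) :
    HasSum (jterm q (gaussFun q) c) (moment q 0 0 c) :=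
  hasSum_of_eq (hasSum_moment hq0 hq1 hc 0 0)
    (fun u => by simp [jterm, hermiteWeight, hermiteII_zero]) rfl

theorem isIntegrable_gaussian (hq0 : 0 < q) (hq1 : q < 1) : IsIntegrable (gaussian q n) := by
  rw [gaussian_eq_sep hq0 hq1]
  exact isIntegrable_sep hq0 (fun _ => realizes_gauss hq0 hq1)
    fun _ c hc => (hasSum_gaussFun hq0 hq1 hc).summable

theorem integral_gaussian (hq0 : 0 < q) (hq1 : q < 1) (b : Fin n → ℕ) {γ : Fin n → ℝ}
    (hγ : ∀ j, γ j ≠ 0) :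
    integral b (gaussian q n) γ = (1 - (q : ℂ) ^ 2) ^ n * (q : ℂ) ^ (n.choose 2 : ℤ) *
      ∏ j, ((q : ℂ) ^ b j * γ j * moment q 0 0 (q ^ b j * (q ^ (n - 1 - (j : ℕ)) * γ j))) := by
  rw [gaussian_eq_sep hq0 hq1]
  exact integral_sep hq0 (fun _ => realizes_gauss hq0 hq1) b γ fun j =>
    hasSum_gaussFun hq0 hq1 (mul_ne_zero (pow_ne_zero _ hq0.ne')
      (mul_ne_zero (pow_ne_zero _ hq0.ne') (hγ j)))

theorem integral_hermiteGaussian (hq0 : 0 < q) (hq1 : q < 1) (a : Fin n → ℕ) (E : Fin n →₀ ℕ)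
    {γ : Fin n → ℝ} (hγ : ∀ j, γ j ≠ 0) :
    integral (fun _ => 0) (evenPart (hermiteGaussian q a * xMonomial q E)) γ =
      (1 - (q : ℂ) ^ 2) ^ n * (q : ℂ) ^ (n.choose 2 : ℤ) *
      ∏ j, (γ j * (((q : ℂ) ^ ((∑ k ∈ Finset.univ.filter (· < j), E k) * E j))⁻¹ *
        (momentRatio q (a j) (E j) * moment q 0 0
          (q ^ (∑ k ∈ Finset.univ.filter (· < j), E k) * (q ^ (n - 1 - (j : ℕ)) * γ j))))) := by
  have hc : ∀ j : Fin n, q ^ (n - 1 - (j : ℕ)) * γ j ≠ 0 := fun j =>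
    mul_ne_zero (pow_ne_zero _ hq0.ne') (hγ j)
  have hs : ∀ j : Fin n, _ := fun j =>
    hasSum_shiftedWeight hq0 hq1 (hc j) (a j) (E j) (∑ k ∈ Finset.univ.filter (· < j), E k)
  rw [evenPart_hermiteGaussian_mul, integral_sep hq0
    (fun j => realizes_shiftedWeight hq0 hq1 (a j) (E j) _) (fun _ => 0) γ
      (fun j => by simpa only [pow_zero, one_mul] using hs j)]
  congr 1
  refine Finset.prod_congr rfl fun j _ => ?_
  rw [pow_zero, one_mul, moment_eq hq0 hq1 (mul_ne_zero (pow_ne_zero _ hq0.ne') (hc j))]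

/-- The sums of `e_k` and of `a_k % 2` differ by an even number `2m`. The resulting `q^{2m}` in the
base point is absorbed by `moment_scale`, exactly against the prefactor. -/
theorem moment_parity (hq0 : 0 < q) (hq1 : q < 1) {c : ℝ} (hc : c ≠ 0) {ι : Type*}
    (t : Finset ι) (e a : ι → ℕ) (h : ∀ k ∈ t, e k % 2 = a k % 2) :
    (q : ℂ) ^ (∑ k ∈ t, e k) * moment q 0 0 (q ^ (∑ k ∈ t, e k) * c) =
      (q : ℂ) ^ (∑ k ∈ t, a k % 2) * moment q 0 0 (q ^ (∑ k ∈ t, a k % 2) * c) := by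
  have hq : (q : ℂ) ≠ 0 := Complex.ofReal_ne_zero.2 hq0.ne'
  have hsum : ∑ k ∈ t, e k = 2 * (∑ k ∈ t, e k / 2) + ∑ k ∈ t, a k % 2 := by
    rw [Finset.mul_sum, ← Finset.sum_add_distrib]
    refine Finset.sum_congr rfl fun k hk => ?_
    have := h k hk
    omega
  set m := ∑ k ∈ t, e k / 2
  set B := ∑ k ∈ t, a k % 2
  rw [hsum, pow_add, pow_add, mul_assoc (q ^ (2 * m))]
  have := moment_scale hq0 hq1 (mul_ne_zero (pow_ne_zero B hq0.ne') hc) 0 0 (m : ℤ)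
  have hz : q ^ (2 * (m : ℤ)) = q ^ (2 * m) := by exact_mod_cast zpow_natCast q (2 * m)
  have hz' : (q : ℂ) ^ (-(2 * (m : ℤ))) = ((q : ℂ) ^ (2 * m))⁻¹ := by
    rw [zpow_neg]
    exact_mod_cast congrArg (·⁻¹) (zpow_natCast (q : ℂ) (2 * m))
  rw [hz, hz'] at this
  rw [this]
  have := pow_ne_zero (2 * m) hq
  field_simp

/-! ### Matching the coefficients of the transform -/

theorem qFactorial_eq (hq0 : 0 < q) (hq1 : q < 1) (e : ℕ) :
    qFactorial (q ^ 2) e = qPoch (q ^ 2) (q ^ 2) e / (1 - q ^ 2) ^ e := by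
  have h : (1 : ℝ) - q ^ 2 ≠ 0 := (sub_pos.2 (pow_lt_one₀ hq0.le hq1 two_ne_zero)).ne'
  have h' : q ^ 2 - 1 ≠ 0 := fun h0 => h (by linarith)
  induction e with
  | zero => simp [qFactorial, qPoch]
  | succ e ih =>
    rw [qFactorial, Finset.prod_range_succ, ← qFactorial, ih, qPoch_self_succ, pow_succ (1 - q ^ 2)]
    field_simp
    ring

/-- The one-variable transform: moment, exponential coefficient and diagonal part of the antipode
eigenvalue. With `e = a + 2k`, the shifted factorials in `e` and the powers of `1 - q²` cancel, the
powers of `q` in `e` cancel, and `(-i)^e = (-i)^a (-1)^k`. What remains is the series of `E_{q⁴}(-q⁴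
X²)`. -/
theorem momentRatio_mul (hq0 : 0 < q) (hq1 : q < 1) (a e : ℕ) :
    momentRatio q a e * ((Complex.I * (q : ℂ) ^ 2 / (1 - (q : ℂ) ^ 2)) ^ e /
        (qFactorial (q ^ 2) e : ℂ)) * ((-1) ^ e * (q : ℂ) ^ ((e : ℤ) ^ 2 - e)) =
      (-Complex.I) ^ a * (q : ℂ) ^ ((a : ℤ) - (a : ℤ) ^ 2) *
        PowerSeries.coeff e (PowerSeries.X ^ a * sqSeries (bigECoeff (q ^ 4)) (-(q : ℂ) ^ 4)) := by
  have hq : (q : ℂ) ≠ 0 := Complex.ofReal_ne_zero.2 hq0.ne'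
  rw [PowerSeries.coeff_X_pow_mul', momentRatio, sqSeries, PowerSeries.coeff_mk, ite_and]
  split_ifs with h1 h2
  · obtain ⟨k, hk⟩ := h2.two_dvd
    rw [hk, Nat.mul_div_cancel_left _ two_pos, qFactorial_eq hq0 hq1, bigECoeff]
    have hp1 : (qPoch (q ^ 2) (q ^ 2) e : ℂ) ≠ 0 := Complex.ofReal_ne_zero.2
      (qPoch_self_ne_zero (by positivity) (pow_lt_one₀ hq0.le hq1 two_ne_zero) e)
    have hp2 : (qPoch (q ^ 4) (q ^ 4) k : ℂ) ≠ 0 := Complex.ofReal_ne_zero.2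
      (qPoch_self_ne_zero (by positivity) (pow_lt_one₀ hq0.le hq1 four_ne_zero) k)
    have hp3 : (1 : ℂ) - (q : ℂ) ^ 2 ≠ 0 := by
      have : (1 : ℝ) - q ^ 2 ≠ 0 := (sub_pos.2 (pow_lt_one₀ hq0.le hq1 two_ne_zero)).ne'
      exact_mod_cast this
    have hI : Complex.I ^ e * (-1) ^ e = (-Complex.I) ^ a * (-1) ^ k := by
      rw [← mul_pow, mul_neg_one, show e = a + 2 * k by omega, pow_add, pow_mul]
      simp
    have hexp : (q : ℂ) ^ (-(e : ℤ) ^ 2 - e + a - (a : ℤ) ^ 2 + 2 * (k : ℤ) ^ 2 + 2 * (k : ℤ)) *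
        ((q : ℂ) ^ 2) ^ e * (q : ℂ) ^ ((e : ℤ) ^ 2 - e) =
        (q : ℂ) ^ ((a : ℤ) - (a : ℤ) ^ 2) * (((q : ℂ) ^ 4) ^ (k * (k - 1) / 2) * ((q : ℂ) ^ 4) ^ k) := by
      have e1 : ((q : ℂ) ^ 2) ^ e = (q : ℂ) ^ (2 * (e : ℤ)) := by
        rw [← pow_mul]
        exact_mod_cast (zpow_natCast (q : ℂ) (2 * e)).symm
      have e2 : ((q : ℂ) ^ 4) ^ (k * (k - 1) / 2) * ((q : ℂ) ^ 4) ^ k =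
          (q : ℂ) ^ (2 * (k : ℤ) ^ 2 + 2 * (k : ℤ)) := by
        have : 4 * (k * (k - 1) / 2) + 4 * k = 2 * k ^ 2 + 2 * k := by
          have h := Nat.mul_div_cancel' (Nat.even_mul_pred_self k).two_dvd
          have : k * (k - 1) + k = k ^ 2 := by
            cases k
            · rfl
            · simp only [Nat.add_sub_cancel]; ring
          omega
        rw [← pow_mul, ← pow_mul, ← pow_add, this]
        exact_mod_cast (zpow_natCast (q : ℂ) (2 * k ^ 2 + 2 * k)).symm
      rw [e1, e2, ← zpow_add₀ hq, ← zpow_add₀ hq, ← zpow_add₀ hq]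
      congr 1
      ring
    rw [div_pow, mul_pow, neg_pow ((q : ℂ) ^ 4) k]
    push_cast
    generalize (q : ℂ) ^ (-(e : ℤ) ^ 2 - e + a - (a : ℤ) ^ 2 + 2 * (k : ℤ) ^ 2 + 2 * (k : ℤ)) = A1
      at hexp ⊢
    generalize (q : ℂ) ^ ((e : ℤ) ^ 2 - e) = A2 at hexp ⊢
    generalize (q : ℂ) ^ ((a : ℤ) - (a : ℤ) ^ 2) = A3 at hexp ⊢
    generalize ((q : ℂ) ^ 4) ^ (k * (k - 1) / 2) = A4 at hexp ⊢
    generalize ((q : ℂ) ^ 4) ^ k = A5 at hexp ⊢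
    generalize ((q : ℂ) ^ 2) ^ e = A6 at hexp ⊢
    have hp4 := pow_ne_zero e hp3
    generalize (1 - (q : ℂ) ^ 2) ^ e = A7 at hp4 ⊢
    field_simp
    linear_combination A1 * A6 * A2 * hI + (-Complex.I) ^ a * (-1) ^ k * hexp
  · simp
  · simp

theorem sum_sq_ordered (f : Fin n → ℤ) :
    (∑ j, f j) ^ 2 =
      ∑ j, (f j ^ 2 + 2 * ((∑ k ∈ Finset.univ.filter (· < j), f k) * f j)) := by
  have h1 : ∀ j k : Fin n, f j * f k = (if k < j then f k * f j else 0) +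
      (if k = j then f j ^ 2 else 0) + (if j < k then f j * f k else 0) := by
    intro j k
    rcases lt_trichotomy k j with h | h | h
    · simp [h, h.ne, h.not_gt, mul_comm]
    · simp [h, pow_two]
    · simp [h, h.ne', h.not_gt]
  have h2 : ∑ j, ∑ k, (if j < k then f j * f k else 0) =
      ∑ j, ∑ k, (if k < j then f k * f j else 0) := Finset.sum_comm
  rw [pow_two, Finset.sum_mul_sum, Finset.sum_congr rfl fun j _ =>
    Finset.sum_congr rfl fun k _ => h1 j k]
  simp only [Finset.sum_add_distrib, h2, Finset.sum_ite_eq', Finset.mem_univ, if_true,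
    Finset.sum_mul, ← Finset.mul_sum, Finset.sum_filter, ite_mul, zero_mul]
  ring

/-- Each `E k` is counted once for every `j > k`. This balances the Jacobians of the rescalings
against the constants `q^{n-j}` of the exponential. -/
theorem sum_lower_eq (E : Fin n → ℕ) :
    ∑ j, ∑ k ∈ Finset.univ.filter (· < j), E k = ∑ j : Fin n, (n - 1 - (j : ℕ)) * E j := by
  simp only [Finset.sum_filter]
  rw [Finset.sum_comm]
  refine Finset.sum_congr rfl fun k _ => ?_
  rw [← Finset.sum_filter, Finset.sum_const, smul_eq_mul]
  have : (Finset.univ.filter fun j : Fin n => k < j) = Finset.Ioi k := by ext; simp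
  rw [this, Fin.card_Ioi]

/-- The basis of the vector algebra is ordered decreasingly, so an increasing product pays `q` for
every pair of letters with different indices. -/
theorem vec_orderWeight (E : Fin n →₀ ℕ) :
    orderWeight (fun i j : Fin n => if i < j then (q : ℂ) else 1) E =
      ∏ j, ((q : ℂ) ^ (∑ k ∈ Finset.univ.filter (· < j), E k)) ^ E j := by
  rw [← weight_cov, orderWeight, weight, weight, Finset.prod_comm]
  refine Finset.prod_congr rfl fun i _ => Finset.prod_congr rfl fun j _ => ?_
  by_cases h : j < i
  · simp [h, mul_comm]
  · simp [h]

theorem vec_diag (q : ℝ) (j : Fin n) : (if j < j then (q : ℂ) else 1) = 1 := by simp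

theorem dd_factor_eq (a : ℕ) (j : Fin n) :
    dd q j ^ a * evalSeries (bigECoeff (q ^ 4)) (-((q : ℂ) ^ 4 • dd q j ^ 2)) =
      embed (fun i j : Fin n => if i < j then (q : ℂ) else 1) j (vec_diag q j)
        (PowerSeries.X ^ a * sqSeries (bigECoeff (q ^ 4)) (-(q : ℂ) ^ 4)) := by
  rw [map_mul, ← evalSeries_embed_sq, embed_smul, map_pow, map_pow, embed_X, neg_smul]
  rfl

theorem fourierS_hermiteGaussian (hq0 : 0 < q) (hq1 : q < 1) (a : Fin n → ℕ) {γ : Fin n → ℝ}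
    (hγ : ∀ j, γ j ≠ 0) :
    fourierS (hermiteGaussian q a) γ =
      (integral (parityShift a) (gaussian q n) γ *
        ((-Complex.I) ^ (∑ j, a j) * (q : ℂ) ^ (∑ j, ((a j : ℤ) - (a j : ℤ) ^ 2)))) •
        (List.ofFn fun j => dd q j ^ a j *
          evalSeries (bigECoeff (q ^ 4)) (-((q : ℂ) ^ 4 • dd q j ^ 2))).prod := by
  have hq : (q : ℂ) ≠ 0 := Complex.ofReal_ne_zero.2 hq0.ne'
  ext E
  simp only [dd_factor_eq]
  rw [coeff_smul, coeff_prod_embed (vec_diag q), vec_orderWeight, fourierS, coeff_antipode]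
  dsimp only
  rw [integral_hermiteGaussian hq0 hq1 a E hγ, integral_gaussian hq0 hq1 _ hγ, expCoeff]
  set s : Fin n → ℕ := fun j => ∑ k ∈ Finset.univ.filter (· < j), E k with hs
  by_cases hE : ∀ j, a j ≤ E j ∧ Even (E j - a j)
  · have hpar : ∀ j, (q : ℂ) ^ s j * moment q 0 0 (q ^ s j * (q ^ (n - 1 - (j : ℕ)) * γ j)) =
        (q : ℂ) ^ parityShift a j *
          moment q 0 0 (q ^ parityShift a j * (q ^ (n - 1 - (j : ℕ)) * γ j)) := fun j =>
      moment_parity hq0 hq1 (mul_ne_zero (pow_ne_zero _ hq0.ne') (hγ j)) _ E a fun k _ => by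
        obtain ⟨h1, m, h2⟩ := hE k
        omega
    have e1 : (-1 : ℂ) ^ E.degree = ∏ j, (-1 : ℂ) ^ E j := by
      rw [Finsupp.degree_eq_sum, Finset.prod_pow_eq_pow_sum]
    -- From `|E|² = ∑ e_j² + 2 ∑ s_j e_j`. One factor `q^{s_j e_j}` will cancel the one from the
    -- integral; the other is the reordering factor of `vec_orderWeight`.
    have e2 : (q : ℂ) ^ (E.degree * (E.degree - 1)) =
        ∏ j, ((q : ℂ) ^ ((E j : ℤ) ^ 2 - E j) * ((q : ℂ) ^ (s j * E j)) ^ 2) := by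
      have hz : ∀ j, (q : ℂ) ^ ((E j : ℤ) ^ 2 - E j) * ((q : ℂ) ^ (s j * E j)) ^ 2 =
          (q : ℂ) ^ (((E j : ℤ) ^ 2 + 2 * ((s j : ℤ) * E j)) - E j) := fun j => by
        rw [← pow_mul, ← zpow_natCast, ← zpow_add₀ hq]
        congr 1
        push_cast
        ring
      rw [Finset.prod_congr rfl fun j _ => hz j, ← zpow_sum₀ hq, ← zpow_natCast]
      congr 1
      have h2 := sum_sq_ordered fun j => (E j : ℤ)
      rw [Finset.sum_sub_distrib]
      have h3 : ∀ j, (s j : ℤ) = ∑ k ∈ Finset.univ.filter (· < j), (E k : ℤ) := fun j => by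
        simp [hs]
      simp only [h3]
      rw [← h2, Finsupp.degree_eq_sum]
      generalize hN : ∑ j, E j = N
      have : ∑ j, (E j : ℤ) = N := by rw [← hN]; push_cast; rfl
      rw [this]
      cases N with
      | zero => simp
      | succ N =>
        push_cast [Nat.add_sub_cancel]
        ring
    have e3 : ∏ j : Fin n, (((q : ℂ) ^ s j)⁻¹ * ((q : ℂ) ^ (n - 1 - (j : ℕ))) ^ E j) = 1 := by
      rw [Finset.prod_mul_distrib, Finset.prod_inv_distrib, Finset.prod_pow_eq_pow_sum,
        Finset.prod_congr rfl fun (j : Fin n) _ => (pow_mul (q : ℂ) (n - 1 - (j : ℕ)) (E j)).symm,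
        Finset.prod_pow_eq_pow_sum, sum_lower_eq, inv_mul_cancel₀ (pow_ne_zero _ hq)]
    have e4 : (-Complex.I) ^ (∑ j, a j) * (q : ℂ) ^ (∑ j, ((a j : ℤ) - (a j : ℤ) ^ 2)) =
        ∏ j, ((-Complex.I) ^ a j * (q : ℂ) ^ ((a j : ℤ) - (a j : ℤ) ^ 2)) := by
      rw [Finset.prod_mul_distrib, Finset.prod_pow_eq_pow_sum, zpow_sum₀ hq]
    -- Removes the common constant `C = (1-q²)ⁿ q^{n(n-1)/2}`.
    have hcomb : ∀ {C A X u v B w y o : ℂ}, A * X * (u * v) = B * w * (y * o) →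
        C * A * X * (u * v) = C * B * w * (y * o) := fun {C} _ _ _ _ _ _ _ _ h => by
      linear_combination C * h
    rw [e1, e2, e4]
    -- The product `e3`, equal to `1`, is inserted on the right. Its factors are not individually
    -- `1`, and only with them does the identity hold for each `j` separately.
    refine hcomb (Eq.trans ?_ ((congrArg (_ * ·) e3).trans (mul_one _)))
    simp only [← Finset.prod_mul_distrib]
    refine Finset.prod_congr rfl fun j _ => ?_
    have h1 := hpar j
    have h2 := momentRatio_mul hq0 hq1 (a j) (E j)
    have hS : (q : ℂ) ^ s j * ((q : ℂ) ^ s j)⁻¹ = 1 := mul_inv_cancel₀ (pow_ne_zero _ hq)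
    have hT : ((q : ℂ) ^ (s j * E j))⁻¹ * ((q : ℂ) ^ (s j * E j)) ^ 2 = (q : ℂ) ^ (s j * E j) := by
      rw [pow_two, inv_mul_cancel_left₀ (pow_ne_zero _ hq)]
    simp only [hs] at h1 hS hT ⊢
    rw [mul_pow (Complex.I * (q : ℂ) ^ 2 / (1 - (q : ℂ) ^ 2)),
      ← pow_mul (q : ℂ) (∑ k ∈ Finset.univ.filter (· < j), E k) (E j)]
    generalize ∑ k ∈ Finset.univ.filter (· < j), E k = t at h1 hS hT ⊢
    generalize moment q 0 0 (q ^ t * (q ^ (n - 1 - (j : ℕ)) * γ j)) = M at h1 ⊢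
    generalize moment q 0 0 (q ^ parityShift a j * (q ^ (n - 1 - (j : ℕ)) * γ j)) = N at h1 ⊢
    generalize (q : ℂ) ^ (t * E j) = T at hT ⊢
    generalize (q : ℂ) ^ t = S at h1 hS ⊢
    generalize ((q : ℂ) ^ (n - 1 - (j : ℕ))) ^ E j = Y
    generalize (Complex.I * (q : ℂ) ^ 2 / (1 - (q : ℂ) ^ 2)) ^ E j = X at h2 ⊢
    generalize (-Complex.I) ^ a j * (q : ℂ) ^ ((a j : ℤ) - (a j : ℤ) ^ 2) = D at h2 ⊢
    generalize PowerSeries.coeff (R := ℂ) (E j) _ = K at h2 ⊢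
    generalize (q : ℂ) ^ ((E j : ℤ) ^ 2 - E j) = Z at h2 ⊢
    generalize (qFactorial (q ^ 2) (E j) : ℂ) = f at h2 ⊢
    linear_combination γ j * momentRatio q (a j) (E j) * M * X * Y / f * (-1) ^ E j * Z * hT +
      γ j * M * Y * T * h2 + γ j * (D * K) * T * Y * (S⁻¹ * h1 - M * hS)
  -- A single index with `e_j < a_j` or `e_j - a_j` odd makes both coefficients vanish.
  · push Not at hE
    obtain ⟨j, hj⟩ := hE
    have h1 : momentRatio q (a j) (E j) = 0 := by
      rw [momentRatio, if_neg]
      rintro ⟨h1, h2⟩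
      exact hj h1 h2
    have h2 : PowerSeries.coeff (E j) (PowerSeries.X ^ a j *
        sqSeries (bigECoeff (q ^ 4)) (-(q : ℂ) ^ 4)) = 0 := by
      rw [PowerSeries.coeff_X_pow_mul', sqSeries, PowerSeries.coeff_mk]
      split_ifs with h3 h4
      · exact absurd h4 (hj h3)
      · rfl
      · rfl
    have h3 : ∏ i, PowerSeries.coeff (E i) (PowerSeries.X ^ a i *
        sqSeries (bigECoeff (q ^ 4)) (-(q : ℂ) ^ 4)) = 0 :=
      Finset.prod_eq_zero (Finset.mem_univ j) h2
    rw [Finset.prod_eq_zero (Finset.mem_univ j) (by rw [h1]; ring), h3]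
    ring

/-! ### From monomials to Hermite I polynomials -/

theorem list_prod_ofFn_smul {m : ℕ} {c : Fin m → Fin m → ℂ} {k : ℕ} (r : Fin k → ℂ)
    (y : Fin k → SkewSeries c) :
    (List.ofFn fun j => r j • y j).prod = (∏ j, r j) • (List.ofFn y).prod := by
  induction k with
  | zero => simp
  | succ k ih =>
    rw [List.ofFn_succ, List.prod_cons, ih, List.ofFn_succ, List.prod_cons, Fin.prod_univ_succ,
      smul_mul_left, mul_smul_right, smul_smul]

/-- `sum_hermiteI` with `p = q²`, multiplied on the right by the `E_{q⁴}` factor; the remaining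
scalar does not depend on `s`. -/
theorem hermiteI_factor (hq0 : 0 < q) (hq1 : q < 1) (a : ℕ) (j : Fin n) :
    ∑ s ∈ Finset.range (a / 2 + 1),
      (((qPoch (q ^ 2) (q ^ 2) a : ℝ) : ℂ) *
        ((-Complex.I) ^ a * (q : ℂ) ^ (-(a : ℤ) ^ 2 + (a : ℤ)) /
          (((qPoch (q ^ 4) (q ^ 4) s : ℝ) : ℂ) * ((qPoch (q ^ 2) (q ^ 2) (a - 2 * s) : ℝ) : ℂ)))) •
        (hermiteI (q ^ 2) (a - 2 * s) (dd q j) *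
          evalSeries (bigECoeff (q ^ 4)) (-((q : ℂ) ^ 4 • dd q j ^ 2))) =
      ((-Complex.I) ^ a * (q : ℂ) ^ ((a : ℤ) - (a : ℤ) ^ 2)) •
        (dd q j ^ a * evalSeries (bigECoeff (q ^ 4)) (-((q : ℂ) ^ 4 • dd q j ^ 2))) := by
  rw [← sum_hermiteI (p := q ^ 2) (by positivity) (pow_lt_one₀ hq0.le hq1 two_ne_zero) a (dd q j),
    Finset.sum_mul, Finset.smul_sum]
  refine Finset.sum_congr rfl fun s _ => ?_
  rw [smul_mul_left, smul_smul, ← pow_mul, neg_add_eq_sub]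
  congr 1
  push_cast
  ring

end BraidedFourier

end

theorem mainTheorem4 (q : ℝ) (hq0 : 0 < q) (hq1 : q < 1) (n : ℕ) (a : Fin n → ℕ) :
    BraidedFourier.ClassR (BraidedFourier.hermiteGaussian q a) ∧
    BraidedFourier.IsIntegrable (BraidedFourier.gaussian q n) ∧
    ∀ γ : Fin n → ℝ, (∀ j, γ j ≠ 0) →
      BraidedFourier.fourierS (BraidedFourier.hermiteGaussian q a) γ =
        BraidedFourier.integral (BraidedFourier.parityShift a) (BraidedFourier.gaussian q n) γ •
          (List.ofFn fun j =>
            ∑ s ∈ Finset.range (a j / 2 + 1),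
              (((BraidedFourier.qPoch (q ^ 2) (q ^ 2) (a j) : ℝ) : ℂ) *
                ((-Complex.I) ^ a j * (q : ℂ) ^ (-(a j : ℤ) ^ 2 + (a j : ℤ)) /
                  (((BraidedFourier.qPoch (q ^ 4) (q ^ 4) s : ℝ) : ℂ) *
                    ((BraidedFourier.qPoch (q ^ 2) (q ^ 2) (a j - 2 * s) : ℝ) : ℂ)))) •
                (BraidedFourier.hermiteI (q ^ 2) (a j - 2 * s) (BraidedFourier.dd q j) *
                  BraidedFourier.SkewSeries.evalSeries (BraidedFourier.bigECoeff (q ^ 4))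
                    (-((q : ℂ) ^ 4 • BraidedFourier.dd q j ^ 2)))).prod ∧
      BraidedFourier.fourierS (BraidedFourier.hermiteGaussian q a) γ =
        (BraidedFourier.integral (BraidedFourier.parityShift a) (BraidedFourier.gaussian q n) γ *
            ((-Complex.I) ^ (∑ j, a j) * (q : ℂ) ^ (∑ j, ((a j : ℤ) - (a j : ℤ) ^ 2)))) •
          (List.ofFn fun j =>
            BraidedFourier.dd q j ^ a j *
              BraidedFourier.SkewSeries.evalSeries (BraidedFourier.bigECoeff (q ^ 4))
                (-((q : ℂ) ^ 4 • BraidedFourier.dd q j ^ 2))).prod := by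
  refine ⟨BraidedFourier.classR_hermiteGaussian hq0 hq1 a,
    BraidedFourier.isIntegrable_gaussian hq0 hq1, fun γ hγ => ?_⟩
  have h := BraidedFourier.fourierS_hermiteGaussian hq0 hq1 a hγ
  refine ⟨?_, h⟩
  simp only [BraidedFourier.hermiteI_factor hq0 hq1]
  rw [BraidedFourier.list_prod_ofFn_smul, smul_smul, h]
  congr 2
  rw [Finset.prod_mul_distrib, Finset.prod_pow_eq_pow_sum,
    BraidedFourier.zpow_sum₀ (Complex.ofReal_ne_zero.2 hq0.ne')]
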